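/- Let $G$ be a compact Lie group with Lie algebra $\mathfrak g=T_eG$ and a bi-invariant Riemannian metric $g_0$, and write $\langle\cdot,\cdot\rangle_0$ for the scalar product that $g_0$ induces on $\mathfrak g$. Let $H\subset G$ be a torus with Lie algebra $\mathfrak h\subset\mathfrak g$, and let $\mathfrak u$ be the $g_0$-orthogonal complement in $\mathfrak g$ of the centralizer of $\mathfrak h$ in $\mathfrak g$. Let $\lambda,\lambda':\mathfrak g\to\mathfrak g$ be linear maps with image contained in $\mathfrak h$ and with $\lambda|_{\mathfrak h\oplus\mathfrak u}=\lambda'|_{\mathfrak h\oplus\mathfrak u}=0$. Assume that for every $Z\in\mathfrak h$ there is $a_Z\in G$ such that $\mathrm{Ad}_{a_Z}|_{\mathfrak h}=\mathrm{Id}$ and $$\langle\lambda'(X),Z\rangle_0=\langle\lambda(\mathrm{Ad}_{a_Z}X),Z\rangle_0\quad\text{for all }X\in\mathfrak g.$$ Let $g_\lambda$ be the left invariant metric on $G$ corresponding to the scalar product $\langle X,Y\rangle_\lambda:=\langle X+\lambda(X),Y+\lambda(Y)\rangle_0$ on $\mathfrak g$, let $\mathrm{Ric}^\lambda$ be its Ricci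 tensor, regarded as a bilinear form on $\mathfrak g$, and let $\|\mathrm{Ric}^\lambda\|_\lambda$ be its norm with respect to $\langle\cdot,\cdot\rangle_\lambda$; define $g_{\lambda'}$, $\mathrm{Ric}^{\lambda'}$ and $\|\mathrm{Ric}^{\lambda'}\|_{\lambda'}$ likewise. Let $j,j':\mathfrak g\to\mathfrak g$ be the transposes of $\lambda,\lambda'$ with respect to $\langle\cdot,\cdot\rangle_0$, write $j_Z:=j(Z)$, $j'_Z:=j'(Z)$, and let $\{Z_1,\dots,Z_r\}$ be a $g_0$-orthonormal basis of $\mathfrak h$. Then $$\|\mathrm{Ric}^\lambda\|_\lambda^2-\|\mathrm{Ric}^{\lambda'}\|_{\lambda'}^2=\frac14\Bigl(\sum_{i,k=1}^r\mathrm{tr}\bigl((\mathrm{ad}_{j_{Z_i}})^2(\mathrm{ad}_{j_{Z_k}})^2\bigr)-\sum_{i,k=1}^r\mathrm{tr}\bigl((\mathrm{ad}_{j'_{Z_i}})^2(\mathrm{ad}_{j'_{Z_k}})^2\bigr)\Bigr).$$ -/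

import Mathlib

open scoped Manifold ContDiff
open Bundle VectorField

namespace LeftInvariantRicci

noncomputable section

/-- A smooth real Lie group has the regularity that Mathlib asks for in order to equip its tangent
space at the identity with the Lie bracket of left invariant vector fields. -/
instance instLieGroupMinSmoothness {E : Type*} [NormedAddCommGroup E] [NormedSpace ℝ E]
    {G : Type*} [TopologicalSpace G] [ChartedSpace E G] [Group G] [LieGroup 𝓘(ℝ, E) ∞ G] :
    LieGroup 𝓘(ℝ, E) (minSmoothness ℝ 3) G :=
  LieGroup.of_le (m := minSmoothness ℝ 3) (n := ∞) (by simpa using! ENat.LEInfty.out)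

/-! ### Linear algebra -/

/-- The centralizer of a subspace of a Lie algebra. -/
def centralizer {L : Type*} [LieRing L] [LieAlgebra ℝ L] (h : Submodule ℝ L) : Submodule ℝ L where
  carrier := {X | ∀ Z ∈ h, ⁅X, Z⁆ = 0}
  add_mem' := fun hX hY Z hZ ↦ by rw [add_lie, hX Z hZ, hY Z hZ, add_zero]
  zero_mem' := fun Z _ ↦ zero_lie Z
  smul_mem' := fun c X hX Z hZ ↦ by rw [smul_lie, hX Z hZ, smul_zero]

/-- The square of the norm, with respect to a scalar product `B`, of a covariant `2`-tensor `b`: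
`B^{ik} B^{jl} b_{ij} b_{kl}` in the components with respect to a basis. -/
def tensorNormSq {V : Type*} [AddCommGroup V] [Module ℝ V] [FiniteDimensional ℝ V]
    (B : LinearMap.BilinForm ℝ V) (b : V → V → ℝ) : ℝ :=
  let e := Module.finBasis ℝ V
  let Q : Matrix _ _ ℝ := (Matrix.of fun i j ↦ B (e i) (e j))⁻¹
  ∑ i, ∑ j, ∑ k, ∑ l, Q i k * Q j l * b (e i) (e j) * b (e k) (e l)

/-! ### Levi-Civita connection and curvature of a metric on a manifold -/

section Manifold

variable {E : Type*} [NormedAddCommGroup E] [NormedSpace ℝ E]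
  {M : Type*} [TopologicalSpace M] [ChartedSpace E M] [IsManifold 𝓘(ℝ, E) ∞ M]

/-- The right-hand side of Koszul's formula,
`½ (X⟨Y,W⟩ + Y⟨X,W⟩ - W⟨X,Y⟩ + ⟨[X,Y],W⟩ - ⟨[X,W],Y⟩ - ⟨[Y,W],X⟩)` at `x`. -/
def koszul (g : ∀ x : M, LinearMap.BilinForm ℝ (TangentSpace 𝓘(ℝ, E) x))
    (X Y W : ∀ x : M, TangentSpace 𝓘(ℝ, E) x) (x : M) : ℝ :=
  (1 / 2) *
    (mvfderiv 𝓘(ℝ, E) (fun y ↦ g y (Y y) (W y)) x (X x)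
      + mvfderiv 𝓘(ℝ, E) (fun y ↦ g y (X y) (W y)) x (Y x)
      - mvfderiv 𝓘(ℝ, E) (fun y ↦ g y (X y) (Y y)) x (W x)
      + g x (mlieBracket 𝓘(ℝ, E) X Y x) (W x)
      - g x (mlieBracket 𝓘(ℝ, E) X W x) (Y x)
      - g x (mlieBracket 𝓘(ℝ, E) Y W x) (X x))

/-- The covariant derivative `∇_X Y` of the Levi-Civita connection of `g`: its value at `x` is the
vector `v` with `⟨v, W⟩ = koszul X Y W` at `x` for all vector fields `W` differentiable at `x`. -/
def leviCivita (g : ∀ x : M, LinearMap.BilinForm ℝ (TangentSpace 𝓘(ℝ, E) x))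
    (X Y : ∀ x : M, TangentSpace 𝓘(ℝ, E) x) (x : M) : TangentSpace 𝓘(ℝ, E) x :=
  Classical.epsilon fun v : TangentSpace 𝓘(ℝ, E) x ↦
    ∀ W : ∀ x : M, TangentSpace 𝓘(ℝ, E) x,
      MDifferentiableAt 𝓘(ℝ, E) (𝓘(ℝ, E).prod 𝓘(ℝ, E))
        (fun y ↦ (W y : TangentBundle 𝓘(ℝ, E) M)) x →
      g x v (W x) = koszul g X Y W x

/-- `R(X,Y)Z = ∇_X ∇_Y Z - ∇_Y ∇_X Z - ∇_[X,Y] Z`. -/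
def curvature (g : ∀ x : M, LinearMap.BilinForm ℝ (TangentSpace 𝓘(ℝ, E) x))
    (X Y Z : ∀ x : M, TangentSpace 𝓘(ℝ, E) x) (x : M) : TangentSpace 𝓘(ℝ, E) x :=
  leviCivita g X (leviCivita g Y Z) x - leviCivita g Y (leviCivita g X Z) x
    - leviCivita g (mlieBracket 𝓘(ℝ, E) X Y) Z x

end Manifold

/-! ### Lie groups with left invariant metrics -/

section Group

variable {E : Type*} [NormedAddCommGroup E] [NormedSpace ℝ E]
  {G : Type*} [TopologicalSpace G] [ChartedSpace E G] [Group G]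

/-- The adjoint representation: `Ad a` is the differential at the identity of `x ↦ a x a⁻¹`. -/
def Ad (a : G) : GroupLieAlgebra 𝓘(ℝ, E) G →ₗ[ℝ] GroupLieAlgebra 𝓘(ℝ, E) G where
  toFun v := mfderiv 𝓘(ℝ, E) 𝓘(ℝ, E) (fun x : G ↦ a * x * a⁻¹) 1 v
  map_add' v w := map_add (mfderiv 𝓘(ℝ, E) 𝓘(ℝ, E) (fun x : G ↦ a * x * a⁻¹) 1) v w
  map_smul' c v := map_smul (mfderiv 𝓘(ℝ, E) 𝓘(ℝ, E) (fun x : G ↦ a * x * a⁻¹) 1) c v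

/-- The differential at `x` of the left translation by `x⁻¹`, from `T_x G` to the Lie algebra. -/
def toLieAlgebra (x : G) : TangentSpace 𝓘(ℝ, E) x →ₗ[ℝ] GroupLieAlgebra 𝓘(ℝ, E) G where
  toFun v := mfderiv 𝓘(ℝ, E) 𝓘(ℝ, E) (fun y : G ↦ x⁻¹ * y) x v
  map_add' v w := map_add (mfderiv 𝓘(ℝ, E) 𝓘(ℝ, E) (fun y : G ↦ x⁻¹ * y) x) v w
  map_smul' c v := map_smul (mfderiv 𝓘(ℝ, E) 𝓘(ℝ, E) (fun y : G ↦ x⁻¹ * y) x) c v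

/-- The left invariant metric on `G` corresponding to the scalar product `B` on the Lie algebra. -/
def leftInvariantMetric (B : LinearMap.BilinForm ℝ (GroupLieAlgebra 𝓘(ℝ, E) G)) (x : G) :
    LinearMap.BilinForm ℝ (TangentSpace 𝓘(ℝ, E) x) :=
  B.compl₁₂ (toLieAlgebra x) (toLieAlgebra x)

/-- A Riemannian metric is bi-invariant if all left and right translations are isometries. -/
def IsBiInvariant [IsManifold 𝓘(ℝ, E) ∞ G]
    (g : ContMDiffRiemannianMetric 𝓘(ℝ, E) ∞ E (fun x : G ↦ TangentSpace 𝓘(ℝ, E) x)) : Prop :=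
  (∀ (a x : G) (v w : TangentSpace 𝓘(ℝ, E) x),
    g.inner (a * x) (mfderiv 𝓘(ℝ, E) 𝓘(ℝ, E) (fun y : G ↦ a * y) x v)
      (mfderiv 𝓘(ℝ, E) 𝓘(ℝ, E) (fun y : G ↦ a * y) x w) = g.inner x v w) ∧
  (∀ (a x : G) (v w : TangentSpace 𝓘(ℝ, E) x),
    g.inner (x * a) (mfderiv 𝓘(ℝ, E) 𝓘(ℝ, E) (fun y : G ↦ y * a) x v)
      (mfderiv 𝓘(ℝ, E) 𝓘(ℝ, E) (fun y : G ↦ y * a) x w) = g.inner x v w)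

/-- The scalar product on the Lie algebra given by a Riemannian metric. -/
def scalarProduct [IsManifold 𝓘(ℝ, E) ∞ G]
    (g : ContMDiffRiemannianMetric 𝓘(ℝ, E) ∞ E (fun x : G ↦ TangentSpace 𝓘(ℝ, E) x)) :
    LinearMap.BilinForm ℝ (GroupLieAlgebra 𝓘(ℝ, E) G) :=
  LinearMap.mk₂ ℝ (fun v w ↦ g.inner 1 v w) (by simp) (by simp) (by simp) (by simp)

theorem scalarProduct_nondegenerate [IsManifold 𝓘(ℝ, E) ∞ G]
    (g : ContMDiffRiemannianMetric 𝓘(ℝ, E) ∞ E (fun x : G ↦ TangentSpace 𝓘(ℝ, E) x)) :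
    (scalarProduct g).Nondegenerate := by
  refine (LinearMap.IsSymm.isRefl ⟨fun v w ↦ g.symm 1 v w⟩).nondegenerate_iff_separatingLeft.mpr ?_
  intro v hv
  by_contra h
  exact (g.pos 1 v h).ne' (hv v)

/-- The differential at the identity of a homomorphism of Lie groups. -/
def differential {F : Type*} [NormedAddCommGroup F] [NormedSpace ℝ F]
    {H : Type*} [TopologicalSpace H] [ChartedSpace F H] [Group H] (i : H →* G) :
    GroupLieAlgebra 𝓘(ℝ, F) H →ₗ[ℝ] GroupLieAlgebra 𝓘(ℝ, E) G where
  toFun v := mfderiv 𝓘(ℝ, F) 𝓘(ℝ, E) (fun x : H ↦ i x) 1 v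
  map_add' v w := map_add (mfderiv 𝓘(ℝ, F) 𝓘(ℝ, E) (fun x : H ↦ i x) 1) v w
  map_smul' c v := map_smul (mfderiv 𝓘(ℝ, F) 𝓘(ℝ, E) (fun x : H ↦ i x) 1) c v

variable [FiniteDimensional ℝ E]

/-- The Lie algebra of `G` is the model space `E` as a vector space. -/
instance instFiniteDimensionalGroupLieAlgebra :
    FiniteDimensional ℝ (GroupLieAlgebra 𝓘(ℝ, E) G) :=
  inferInstanceAs (FiniteDimensional ℝ E)

/-- The Ricci tensor at the identity of a metric `g` on a Lie group: `Ric(v,w)` is the trace of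
`u ↦ R(u,v)w`. By tensoriality of the curvature, the vectors may be extended to any smooth vector
fields; the left invariant ones are used. -/
def ricci [LieGroup 𝓘(ℝ, E) ∞ G] (g : ∀ x : G, LinearMap.BilinForm ℝ (TangentSpace 𝓘(ℝ, E) x))
    (v w : GroupLieAlgebra 𝓘(ℝ, E) G) : ℝ :=
  ∑ i, (Module.finBasis ℝ (GroupLieAlgebra 𝓘(ℝ, E) G)).coord i
    (curvature g
      (mulInvariantVectorField (Module.finBasis ℝ (GroupLieAlgebra 𝓘(ℝ, E) G) i))
      (mulInvariantVectorField v) (mulInvariantVectorField w) 1)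

/-- The transpose of an endomorphism of the Lie algebra with respect to the scalar product:
`⟨transpose φ X, Y⟩ = ⟨X, φ Y⟩`. -/
def transpose [IsManifold 𝓘(ℝ, E) ∞ G]
    (g : ContMDiffRiemannianMetric 𝓘(ℝ, E) ∞ E (fun x : G ↦ TangentSpace 𝓘(ℝ, E) x))
    (φ : GroupLieAlgebra 𝓘(ℝ, E) G →ₗ[ℝ] GroupLieAlgebra 𝓘(ℝ, E) G) :
    GroupLieAlgebra 𝓘(ℝ, E) G →ₗ[ℝ] GroupLieAlgebra 𝓘(ℝ, E) G :=
  LinearMap.BilinForm.leftAdjointOfNondegenerate (scalarProduct g) (scalarProduct_nondegenerate g) φ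

/-- The linear maps `φ : 𝔤 → 𝔤` with image in `𝔥` that vanish on `𝔥 ⊕ 𝔲`, where `𝔲` is the
`B`-orthogonal complement of the centralizer of `𝔥`. -/
structure IsAdmissible [LieGroup 𝓘(ℝ, E) ∞ G]
    (B : LinearMap.BilinForm ℝ (GroupLieAlgebra 𝓘(ℝ, E) G))
    (h : Submodule ℝ (GroupLieAlgebra 𝓘(ℝ, E) G))
    (φ : GroupLieAlgebra 𝓘(ℝ, E) G →ₗ[ℝ] GroupLieAlgebra 𝓘(ℝ, E) G) : Prop where
  map_mem : ∀ X, φ X ∈ h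
  map_eq_zero : ∀ X ∈ h ⊔ B.orthogonal (centralizer h), φ X = 0

/-- The scalar product `(Id + φ)^* B`, that is, `(X, Y) ↦ B (X + φ X) (Y + φ Y)`. -/
def pullbackForm {V : Type*} [AddCommGroup V] [Module ℝ V] (B : LinearMap.BilinForm ℝ V)
    (φ : V →ₗ[ℝ] V) : LinearMap.BilinForm ℝ V :=
  B.compl₁₂ (LinearMap.id + φ) (LinearMap.id + φ)

end Group

end

end LeftInvariantRicci

open LeftInvariantRicci

namespace LeftInvariantRicci

/-! ### Levi-Civita connection and Ricci tensor of a left invariant metric. -/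

section Group

variable {E : Type*} [NormedAddCommGroup E] [NormedSpace ℝ E]
  {G : Type*} [TopologicalSpace G] [ChartedSpace E G] [Group G]

/-! Write B for the bi-invariant scalar product on 𝔤. Since λ maps into 𝔥 and vanishes there, λ² = 0
and 1 + λ has inverse 1 - λ. It is an isometry from the metric λ-form to B that carries the Lie
bracket to the twisted bracket [x,y] + λ[x,y] - [λx,y] - [x,λy]. All curvature is computed in this
picture, where only the bracket has changed.

The facts behind every cancellation (`IsTwist`) are that ad is skew for B, that 𝔥 is abelian, and
that λ kills [𝔥,𝔤]. The last holds because [𝔥,𝔤] is orthogonal to the centralizer of 𝔥; dually, the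
image of j commutes with 𝔥. Koszul's formula then gives the connection in closed form
(`koszul_twistConnection`). It is trace free in its first argument, so Ric(v,w) = -tr(D_·w ∘ D_·v),
and expanding this (`trace_twistConnection_flip_mul`) yields the Ricci operator R = ½S + N -
¼(1+λ)K(1+j), where S = Σ ad(jZ_k)², N = Σ ad(Z_k) ad(jZ_k), and K represents the Killing form
through B. The squared norm of Ric is tr R² (`tensorNormSq_eq_trace`).

It remains to compare tr R² for λ and λ'. The hypothesis supplies, for each single z in 𝔥, an
isometric automorphism fixing 𝔥 and sending j'z to jz (`isAligned_of_Ad`). Hence any trace that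
involves j at one z only is the same on both sides. Traces involving j at several points are reduced
to this case by polarization: ad(𝔥) commutes with ad(j𝔤), so the terms of tr N² and tr SN polarize
forms tr(w ad(jz)²) and tr(w ad(jz)³), and the Killing terms polarize a symmetric bilinear form. The
one term this argument does not reach is ¼ tr S², where ad(jZ_i) and ad(jZ_k) need not commute; it
is the right-hand side. -/

theorem leftInvariantMetric_apply (B : LinearMap.BilinForm ℝ (GroupLieAlgebra 𝓘(ℝ, E) G)) (x : G)
    (v w : TangentSpace 𝓘(ℝ, E) x) :
    leftInvariantMetric B x v w = B (toLieAlgebra x v) (toLieAlgebra x w) := rfl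

theorem mulInvariantVectorField_one (v : GroupLieAlgebra 𝓘(ℝ, E) G) :
    mulInvariantVectorField v (1 : G) = v := by
  have h : (fun y : G ↦ 1 * y) = id := by ext; simp
  simp only [mulInvariantVectorField]
  rw [h, mfderiv_id]
  rfl

section Translations

variable [LieGroup 𝓘(ℝ, E) ∞ G]

theorem contMDiff_conj (a : G) :
    ContMDiff 𝓘(ℝ, E) 𝓘(ℝ, E) ∞ (fun x : G ↦ a * x * a⁻¹) :=
  (contMDiff_mul_left (I := 𝓘(ℝ, E)) (n := ∞) (a := a)).mul contMDiff_const

theorem mdifferentiableAt_mul_left (a x : G) :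
    MDifferentiableAt 𝓘(ℝ, E) 𝓘(ℝ, E) (fun y : G ↦ a * y) x :=
  (contMDiff_mul_left (I := 𝓘(ℝ, E)) (n := ∞) (a := a)).mdifferentiableAt (by simp)

theorem mdifferentiableAt_mul_right (a x : G) :
    MDifferentiableAt 𝓘(ℝ, E) 𝓘(ℝ, E) (fun y : G ↦ y * a) x :=
  (contMDiff_mul_right (I := 𝓘(ℝ, E)) (n := ∞) (a := a)).mdifferentiableAt (by simp)

theorem mdifferentiableAt_conj (a x : G) :
    MDifferentiableAt 𝓘(ℝ, E) 𝓘(ℝ, E) (fun y : G ↦ a * y * a⁻¹) x :=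
  (contMDiff_conj a).mdifferentiableAt (by simp)

theorem toLieAlgebra_mulInvariantVectorField (x : G) (v : GroupLieAlgebra 𝓘(ℝ, E) G) :
    toLieAlgebra x (mulInvariantVectorField v x) = v := by
  have h := mfderiv_comp_apply (I := 𝓘(ℝ, E)) (I' := 𝓘(ℝ, E)) (I'' := 𝓘(ℝ, E)) (1 : G)
    (mdifferentiableAt_mul_left x⁻¹ (x * 1)) (mdifferentiableAt_mul_left x 1) v
  have h' : (fun y : G ↦ x⁻¹ * y) ∘ (fun y : G ↦ x * y) = id := by ext; simp
  rw [h', mfderiv_id] at h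
  have h'' : x * 1 = x := mul_one x
  simp only [toLieAlgebra, mulInvariantVectorField]
  rw [h''] at h
  exact h.symm

theorem mulInvariantVectorField_toLieAlgebra (x : G) (v : TangentSpace 𝓘(ℝ, E) x) :
    mulInvariantVectorField (toLieAlgebra x v) x = v := by
  have h := mfderiv_comp_apply (I := 𝓘(ℝ, E)) (I' := 𝓘(ℝ, E)) (I'' := 𝓘(ℝ, E)) x
    (mdifferentiableAt_mul_left x (x⁻¹ * x)) (mdifferentiableAt_mul_left x⁻¹ x) v
  have h' : (fun y : G ↦ x * y) ∘ (fun y : G ↦ x⁻¹ * y) = id := by ext; simp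
  rw [h', mfderiv_id] at h
  have h'' : x⁻¹ * x = 1 := inv_mul_cancel x
  simp only [toLieAlgebra, mulInvariantVectorField]
  rw [h''] at h
  exact h.symm

theorem leftInvariantMetric_mulInvariantVectorField (B : LinearMap.BilinForm ℝ (GroupLieAlgebra 𝓘(ℝ, E) G))
    (Y : GroupLieAlgebra 𝓘(ℝ, E) G) (x : G)
    (v : TangentSpace 𝓘(ℝ, E) x) :
    leftInvariantMetric B x (mulInvariantVectorField Y x) v = B Y (toLieAlgebra x v) := by
  rw [leftInvariantMetric_apply, toLieAlgebra_mulInvariantVectorField]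

/-- The vector dL_{y⁻¹}W(y) is the image of (0_y, W(y)) under the tangent map of the smooth map
(a,b) ↦ a⁻¹b, which is how its dependence on y is controlled. -/
theorem mdifferentiableAt_toLieAlgebra [FiniteDimensional ℝ E]
    (ℓ : GroupLieAlgebra 𝓘(ℝ, E) G →ₗ[ℝ] ℝ) {W : ∀ x : G, TangentSpace 𝓘(ℝ, E) x} {x : G}
    (hW : MDifferentiableAt 𝓘(ℝ, E) (𝓘(ℝ, E).prod 𝓘(ℝ, E))
        (fun y ↦ (W y : TangentBundle 𝓘(ℝ, E) G)) x) :
    MDifferentiableAt 𝓘(ℝ, E) 𝓘(ℝ, ℝ) (fun y : G ↦ ℓ (toLieAlgebra y (W y))) x := by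
  have hdiv : ContMDiff (𝓘(ℝ, E).prod 𝓘(ℝ, E)) 𝓘(ℝ, E) ∞ (fun p : G × G ↦ p.1⁻¹ * p.2) :=
    (contMDiff_fst.inv).mul contMDiff_snd
  have h₁ : MDifferentiableAt 𝓘(ℝ, E) ((𝓘(ℝ, E).prod 𝓘(ℝ, E)).prod (𝓘(ℝ, E).prod 𝓘(ℝ, E)))
      (fun y : G ↦ ((TotalSpace.mk' E y 0 : TangentBundle 𝓘(ℝ, E) G),
        (W y : TangentBundle 𝓘(ℝ, E) G))) x :=
    MDifferentiableAt.prodMk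
      ((contMDiff_zeroSection (n := 1) ℝ (fun x : G ↦ TangentSpace 𝓘(ℝ, E) x)).mdifferentiableAt
        (by simp)) hW
  have h₂ : ContMDiff ((𝓘(ℝ, E).prod 𝓘(ℝ, E)).prod (𝓘(ℝ, E).prod 𝓘(ℝ, E)))
      ((𝓘(ℝ, E).prod 𝓘(ℝ, E)).prod (𝓘(ℝ, E × E))) 1
      (equivTangentBundleProd 𝓘(ℝ, E) G 𝓘(ℝ, E) G).symm :=
    contMDiff_equivTangentBundleProd_symm
  have h₃ := hdiv.contMDiff_tangentMap (m := 1) (by norm_cast)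
  have h₄ := (h₃.mdifferentiableAt (by simp)).comp x ((h₂.mdifferentiableAt (by simp)).comp x h₁)
  have h₅ : (tangentMap (𝓘(ℝ, E).prod 𝓘(ℝ, E)) 𝓘(ℝ, E) (fun p : G × G ↦ p.1⁻¹ * p.2)) ∘
      (equivTangentBundleProd 𝓘(ℝ, E) G 𝓘(ℝ, E) G).symm ∘
      (fun y : G ↦ ((TotalSpace.mk' E y 0 : TangentBundle 𝓘(ℝ, E) G),
        (W y : TangentBundle 𝓘(ℝ, E) G))) =
      fun y ↦ (TotalSpace.mk' E (1 : G) (toLieAlgebra y (W y)) : TangentBundle 𝓘(ℝ, E) G) := by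
    funext y
    simp only [Function.comp_apply, tangentMap]
    rw [mfderiv_prod_eq_add_apply (hdiv.mdifferentiableAt (by simp))]
    -- The base point y⁻¹y equals 1 only propositionally, so fibres are identified after
    -- generalizing it.
    have aux : ∀ (a : G) (_ : a = 1) (v w : E), v = w →
      (TotalSpace.mk' E a v : TangentBundle 𝓘(ℝ, E) G) = TotalSpace.mk' E (1 : G) w := by
      rintro a rfl v w rfl; rfl
    refine aux _ (inv_mul_cancel y) _ _ ?_
    simp +instances [toLieAlgebra, equivTangentBundleProd]
    rfl
  rw [h₅, mdifferentiableAt_totalSpace] at h₄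
  have h₆ : (fun y : G ↦ ℓ (toLieAlgebra y (W y))) =
      (LinearMap.toContinuousLinearMap (show E →ₗ[ℝ] ℝ from ℓ)) ∘ fun y : G ↦
        (trivializationAt E (TangentSpace 𝓘(ℝ, E)) (1 : G)
          (TotalSpace.mk' E (1 : G) (toLieAlgebra y (W y)))).2 := by
    funext y
    exact congrArg ℓ ((tangentBundleCore 𝓘(ℝ, E) G).coordChange_self (achart E (1 : G)) 1
      (mem_achart_source E (1 : G)) (toLieAlgebra y (W y))).symm
  rw [h₆]
  exact (ContinuousLinearMap.mdifferentiableAt _).comp x h₄.2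

theorem mlieBracket_mulInvariantVectorField [CompleteSpace E] (v w : GroupLieAlgebra 𝓘(ℝ, E) G) :
    mlieBracket 𝓘(ℝ, E) (mulInvariantVectorField v) (mulInvariantVectorField w) =
      mulInvariantVectorField (G := G) ⁅v, w⁆ :=
  (mulInvariantVector_mlieBracket v w).symm

variable [FiniteDimensional ℝ E] (B : LinearMap.BilinForm ℝ (GroupLieAlgebra 𝓘(ℝ, E) G))

/-- Replacing W by fW produces derivatives of f both from the metric terms and from the brackets,
and these cancel. Consequently left invariant test fields suffice in the definition of the
connection. -/
theorem tensorialAt_koszul (hB : B.IsSymm) (X Y : GroupLieAlgebra 𝓘(ℝ, E) G) (x : G) :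
    TensorialAt 𝓘(ℝ, E) E (fun W : ∀ x : G, TangentSpace 𝓘(ℝ, E) x ↦
      koszul (leftInvariantMetric B) (mulInvariantVectorField X) (mulInvariantVectorField Y) W x)
      x where
  smul := by
    intro f W hf hW
    have hd := fun Y ↦ mdifferentiableAt_toLieAlgebra (B Y) hW
    have hmul : ∀ Y : GroupLieAlgebra 𝓘(ℝ, E) G, (fun y ↦ B Y (toLieAlgebra y ((f • W) y))) =
        f * fun y ↦ B Y (toLieAlgebra y (W y)) := by
      intro Y; funext y
      simp
    simp only [koszul, leftInvariantMetric_mulInvariantVectorField,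
      toLieAlgebra_mulInvariantVectorField, hmul, mvfderiv_const]
    rw [mlieBracket_smul_right hf hW, mlieBracket_smul_right hf hW, mvfderiv_mul hf (hd _),
      mvfderiv_mul hf (hd _)]
    simp only [leftInvariantMetric_apply, toLieAlgebra_mulInvariantVectorField, map_add, map_smul,
      LinearMap.add_apply, LinearMap.smul_apply, _root_.add_apply, smul_eq_mul,
      _root_.smul_apply, _root_.zero_apply, Pi.smul_apply',
      hB.eq (toLieAlgebra x (W x))]
    ring
  add := by
    intro W W' hW hW'
    have hd := fun Y ↦ mdifferentiableAt_toLieAlgebra (B Y) hW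
    have hd' := fun Y ↦ mdifferentiableAt_toLieAlgebra (B Y) hW'
    have hadd : ∀ Y : GroupLieAlgebra 𝓘(ℝ, E) G, (fun y ↦ B Y (toLieAlgebra y ((W + W') y))) =
        (fun y ↦ B Y (toLieAlgebra y (W y))) + fun y ↦ B Y (toLieAlgebra y (W' y)) := by
      intro Y; funext y
      simp
    simp only [koszul, leftInvariantMetric_mulInvariantVectorField,
      toLieAlgebra_mulInvariantVectorField, hadd, mvfderiv_const]
    rw [mlieBracket_add_right hW hW', mlieBracket_add_right hW hW', mvfderiv_add (hd _) (hd' _),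
      mvfderiv_add (hd _) (hd' _)]
    simp only [leftInvariantMetric_apply, toLieAlgebra_mulInvariantVectorField, map_add,
      LinearMap.add_apply, _root_.add_apply, _root_.zero_apply,
      Pi.add_apply]
    ring

/-- The algebraic Koszul formula: `nabla X Y` is the covariant derivative at the identity of the
left invariant field `Y` in the direction `X`. -/
theorem leviCivita_leftInvariantMetric (hB : B.Nondegenerate) (hs : B.IsSymm)
    (X Y V : GroupLieAlgebra 𝓘(ℝ, E) G)
    (hV : ∀ W, B V W = 1 / 2 * (B ⁅X, Y⁆ W - B ⁅X, W⁆ Y - B ⁅Y, W⁆ X)) :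
    leviCivita (leftInvariantMetric B) (mulInvariantVectorField X) (mulInvariantVectorField Y) =
      mulInvariantVectorField (G := G) V := by
  have hK : ∀ (W : GroupLieAlgebra 𝓘(ℝ, E) G) (x : G), koszul (leftInvariantMetric B)
      (mulInvariantVectorField X) (mulInvariantVectorField Y) (mulInvariantVectorField W) x =
      B V W := by
    intro W x
    simp only [koszul, leftInvariantMetric_apply, toLieAlgebra_mulInvariantVectorField,
      mlieBracket_mulInvariantVectorField, mvfderiv_const, hV]
    simp
  funext x
  have hex : ∃ v : TangentSpace 𝓘(ℝ, E) x, ∀ W : ∀ x : G, TangentSpace 𝓘(ℝ, E) x,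
      MDifferentiableAt 𝓘(ℝ, E) (𝓘(ℝ, E).prod 𝓘(ℝ, E))
        (fun y ↦ (W y : TangentBundle 𝓘(ℝ, E) G)) x →
      leftInvariantMetric B x v (W x) = koszul (leftInvariantMetric B) (mulInvariantVectorField X)
        (mulInvariantVectorField Y) W x := by
    refine ⟨mulInvariantVectorField V x, fun W hW ↦ ?_⟩
    rw [(tensorialAt_koszul B hs X Y x).pointwise hW
      (mdifferentiableAt_mulInvariantVectorField (toLieAlgebra x (W x)))
      (mulInvariantVectorField_toLieAlgebra x (W x)).symm, hK, leftInvariantMetric_apply,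
      toLieAlgebra_mulInvariantVectorField]
  -- The chosen vector is pinned down by nondegeneracy, tested on left invariant fields.
  have h := Classical.epsilon_spec hex
  set u := Classical.epsilon fun v : TangentSpace 𝓘(ℝ, E) x ↦ ∀ W : ∀ x : G,
      TangentSpace 𝓘(ℝ, E) x, MDifferentiableAt 𝓘(ℝ, E) (𝓘(ℝ, E).prod 𝓘(ℝ, E))
        (fun y ↦ (W y : TangentBundle 𝓘(ℝ, E) G)) x →
      leftInvariantMetric B x v (W x) = koszul (leftInvariantMetric B) (mulInvariantVectorField X)
        (mulInvariantVectorField Y) W x with hu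
  change u = _
  have hu' : toLieAlgebra x u = V := by
    rw [← sub_eq_zero]
    refine hB.1 _ fun W ↦ ?_
    have := h (mulInvariantVectorField W) (mdifferentiableAt_mulInvariantVectorField W)
    rw [hK, leftInvariantMetric_apply, toLieAlgebra_mulInvariantVectorField] at this
    rw [map_sub, LinearMap.sub_apply, this, sub_self]
  rw [← hu', mulInvariantVectorField_toLieAlgebra]

/-- The Ricci tensor of a left invariant metric whose Levi-Civita connection is given on left
invariant fields by `D`, when `D` is trace free in its first argument. -/
theorem ricci_leftInvariantMetric (hB : B.Nondegenerate) (hs : B.IsSymm)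
    (D : GroupLieAlgebra 𝓘(ℝ, E) G →ₗ[ℝ] GroupLieAlgebra 𝓘(ℝ, E) G →ₗ[ℝ]
      GroupLieAlgebra 𝓘(ℝ, E) G)
    (hD : ∀ X Y W, B (D X Y) W = 1 / 2 * (B ⁅X, Y⁆ W - B ⁅X, W⁆ Y - B ⁅Y, W⁆ X))
    (htr : ∀ W, LinearMap.trace ℝ _ (D.flip W) = 0) (v w : GroupLieAlgebra 𝓘(ℝ, E) G) :
    ricci (leftInvariantMetric B) v w = - LinearMap.trace ℝ _ (D.flip w * D.flip v) := by
  have hLC : ∀ X Y, leviCivita (leftInvariantMetric B) (mulInvariantVectorField X)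
      (mulInvariantVectorField Y) = mulInvariantVectorField (G := G) (D X Y) := fun X Y ↦
    leviCivita_leftInvariantMetric B hB hs X Y (D X Y) (hD X Y)
  have htors : ∀ X Y, ⁅X, Y⁆ = D X Y - D Y X := by
    intro X Y
    rw [← sub_eq_zero]
    refine hB.1 _ fun W ↦ ?_
    simp only [map_sub, LinearMap.sub_apply, hD]
    rw [← lie_skew X Y, map_neg, LinearMap.neg_apply]
    ring
  have hcurv : ∀ X, curvature (leftInvariantMetric B) (mulInvariantVectorField X)
      (mulInvariantVectorField v) (mulInvariantVectorField w) (1 : G) =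
      (D.flip (D v w) - D v * D.flip w - (D.flip w * D.flip v - D.flip w * D v)) X := by
    intro X
    simp only [curvature, hLC, mlieBracket_mulInvariantVectorField, mulInvariantVectorField_one]
    simp [htors]
  have htrace := LinearMap.trace_eq_matrix_trace ℝ
    (Module.finBasis ℝ (GroupLieAlgebra 𝓘(ℝ, E) G))
    (D.flip (D v w) - D v * D.flip w - (D.flip w * D.flip v - D.flip w * D v))
  simp only [ricci, hcurv]
  rw [Matrix.trace] at htrace
  simp only [Matrix.diag_apply, LinearMap.toMatrix_apply] at htrace
  refine htrace.symm.trans ?_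
  -- `D.flip (D v w)` is trace free, and the two products of `D v` with `D.flip w` cancel by
  -- cyclicity.
  simp only [map_sub, htr]
  rw [LinearMap.trace_mul_comm ℝ (D v)]
  ring

end Translations
end Group

/-! ### The adjoint representation, its differential, and invariance of the scalar product. -/

section Adjoint

variable {E : Type*} [NormedAddCommGroup E] [NormedSpace ℝ E]
  {G : Type*} [TopologicalSpace G] [ChartedSpace E G] [Group G] [LieGroup 𝓘(ℝ, E) ∞ G]

theorem Ad_apply {E : Type*} [NormedAddCommGroup E] [NormedSpace ℝ E]
    {G : Type*} [TopologicalSpace G] [ChartedSpace E G] [Group G] (a : G) (v : GroupLieAlgebra 𝓘(ℝ, E) G) :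
    Ad a v = mfderiv 𝓘(ℝ, E) 𝓘(ℝ, E) (fun x : G ↦ a * x * a⁻¹) 1 v := rfl

theorem scalarProduct_isSymm (g : ContMDiffRiemannianMetric 𝓘(ℝ, E) ∞ E
    (fun x : G ↦ TangentSpace 𝓘(ℝ, E) x)) : (scalarProduct g).IsSymm :=
  ⟨fun v w ↦ g.symm 1 v w⟩

theorem inner_Ad_Ad {g : ContMDiffRiemannianMetric 𝓘(ℝ, E) ∞ E
    (fun x : G ↦ TangentSpace 𝓘(ℝ, E) x)} (hg : IsBiInvariant g) (a : G)
    (v w : GroupLieAlgebra 𝓘(ℝ, E) G) :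
    scalarProduct g (Ad a v) (Ad a w) = scalarProduct g v w := by
  have hcomp : ∀ u : GroupLieAlgebra 𝓘(ℝ, E) G, Ad a u =
      mfderiv 𝓘(ℝ, E) 𝓘(ℝ, E) (fun y : G ↦ y * a⁻¹) (a * 1)
        (mfderiv 𝓘(ℝ, E) 𝓘(ℝ, E) (fun y : G ↦ a * y) 1 u) := fun u ↦
    mfderiv_comp_apply (I' := 𝓘(ℝ, E)) (1 : G)
      (mdifferentiableAt_mul_right a⁻¹ (a * 1)) (mdifferentiableAt_mul_left a 1) u
  have hbase : ∀ (b : G) (_ : b = 1) (v w : E), g.inner b v w = g.inner (1 : G) v w := by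
    rintro b rfl v w; rfl
  rw [hcomp, hcomp]
  change g.inner (1 : G) _ _ = g.inner (1 : G) _ _
  rw [← hg.1 a 1 v w, ← hg.2 a⁻¹ (a * 1)]
  exact (hbase _ (by simp) _ _).symm

theorem Ad_mulInvariantVectorField (a x : G) (v : GroupLieAlgebra 𝓘(ℝ, E) G) :
    mfderiv 𝓘(ℝ, E) 𝓘(ℝ, E) (fun y : G ↦ a * y * a⁻¹) x (mulInvariantVectorField v x) =
      mulInvariantVectorField (Ad a v) (a * x * a⁻¹) := by
  have h₁ := mfderiv_comp_apply (I := 𝓘(ℝ, E)) (I' := 𝓘(ℝ, E)) (I'' := 𝓘(ℝ, E)) (1 : G)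
    (mdifferentiableAt_conj a (x * 1)) (mdifferentiableAt_mul_left x 1) v
  have h₂ := mfderiv_comp_apply (I := 𝓘(ℝ, E)) (I' := 𝓘(ℝ, E)) (I'' := 𝓘(ℝ, E)) (1 : G)
    (mdifferentiableAt_mul_left (a * x * a⁻¹) (a * 1 * a⁻¹)) (mdifferentiableAt_conj a 1) v
  have h₃ : (fun y : G ↦ a * y * a⁻¹) ∘ (fun y : G ↦ x * y) =
      (fun y : G ↦ a * x * a⁻¹ * y) ∘ (fun y : G ↦ a * y * a⁻¹) := by
    ext y; simp [mul_assoc]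
  rw [h₃] at h₁
  have h₄ := h₁.symm.trans h₂
  have h₅ : a * 1 * a⁻¹ = 1 := by simp
  rw [h₅, mul_one] at h₄
  exact h₄

theorem Ad_inv_Ad (a : G) (v : GroupLieAlgebra 𝓘(ℝ, E) G) : Ad a⁻¹ (Ad a v) = v := by
  have h := mfderiv_comp_apply (I := 𝓘(ℝ, E)) (I' := 𝓘(ℝ, E)) (I'' := 𝓘(ℝ, E)) (1 : G)
    (mdifferentiableAt_conj a⁻¹ (a * 1 * a⁻¹)) (mdifferentiableAt_conj a 1) v
  have h' : (fun y : G ↦ a⁻¹ * y * a⁻¹⁻¹) ∘ (fun y : G ↦ a * y * a⁻¹) = id := by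
    ext; simp [mul_assoc]
  rw [h', mfderiv_id] at h
  have h₅ : a * 1 * a⁻¹ = 1 := by simp
  rw [h₅] at h
  exact h.symm


/-- Conjugation is a diffeomorphism relating left invariant fields to left invariant fields, and
pullback by a diffeomorphism commutes with brackets. -/
theorem Ad_lie [FiniteDimensional ℝ E] (a : G) (v w : GroupLieAlgebra 𝓘(ℝ, E) G) : Ad a ⁅v, w⁆ = ⁅Ad a v, Ad a w⁆ := by
  have hinv : ∀ x : G, (mfderiv 𝓘(ℝ, E) 𝓘(ℝ, E) (fun y : G ↦ a * y * a⁻¹) x).IsInvertible := by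
    intro x
    let Φ : Diffeomorph 𝓘(ℝ, E) 𝓘(ℝ, E) G G ∞ :=
      { toEquiv := (MulAut.conj a).toEquiv
        contMDiff_toFun := contMDiff_conj a
        contMDiff_invFun := by simpa using! contMDiff_conj (E := E) a⁻¹ }
    exact ⟨Φ.mfderivToContinuousLinearEquiv (by simp) x, rfl⟩
  have hpull : ∀ u : GroupLieAlgebra 𝓘(ℝ, E) G, mpullback 𝓘(ℝ, E) 𝓘(ℝ, E)
      (fun y : G ↦ a * y * a⁻¹) (mulInvariantVectorField (Ad a u)) = mulInvariantVectorField u := by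
    intro u
    funext x
    rw [mpullback_apply, ← Ad_mulInvariantVectorField]
    exact (hinv x).inverse_apply_self _
  have h := mpullback_mlieBracket (I := 𝓘(ℝ, E)) (I' := 𝓘(ℝ, E)) (n := ∞)
    (f := fun y : G ↦ a * y * a⁻¹) (x₀ := (1 : G))
    (mdifferentiableAt_mulInvariantVectorField (Ad a v))
    (mdifferentiableAt_mulInvariantVectorField (Ad a w)) (contMDiff_conj a).contMDiffAt
    (by simpa using! ENat.LEInfty.out)
  rw [hpull, hpull, mlieBracket_mulInvariantVectorField, mlieBracket_mulInvariantVectorField,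
    mpullback_apply, mulInvariantVectorField_one] at h
  rw [← h, Ad_apply, (hinv 1).self_apply_inverse]
  have hbase : ∀ (b : G) (_ : b = 1) (u : GroupLieAlgebra 𝓘(ℝ, E) G),
      (mulInvariantVectorField u b : E) = u := by
    rintro b rfl u; exact mulInvariantVectorField_one u
  exact hbase _ (by simp) _

/-- The multiplication of a Lie group in the preferred chart at the identity. -/
noncomputable def chartMul (E : Type*) [NormedAddCommGroup E] [NormedSpace ℝ E]
    (G : Type*) [TopologicalSpace G] [ChartedSpace E G] [Group G] (p : E × E) : E :=
  extChartAt 𝓘(ℝ, E) (1 : G)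
    ((extChartAt 𝓘(ℝ, E) (1 : G)).symm p.1 * (extChartAt 𝓘(ℝ, E) (1 : G)).symm p.2)

local notation "φ" => extChartAt 𝓘(ℝ, E) (1 : G)

theorem contDiffAt_chartMul {p : E × E} (h₁ : p.1 ∈ (φ).target) (h₂ : p.2 ∈ (φ).target)
    (h₃ : (φ).symm p.1 * (φ).symm p.2 ∈ (φ).source) : ContDiffAt ℝ ∞ (chartMul E G) p := by
  rw [← contMDiffAt_iff_contDiffAt]
  have hsymm : ∀ q ∈ (φ).target, ContMDiffAt 𝓘(ℝ, E) 𝓘(ℝ, E) ∞ (φ).symm q := fun q hq ↦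
    (contMDiffOn_extChartAt_symm (1 : G)).contMDiffAt ((isOpen_extChartAt_target (1 : G)).mem_nhds hq)
  have hmul : ContMDiffAt 𝓘(ℝ, E × E) 𝓘(ℝ, E) ∞
      (fun p : E × E ↦ (φ).symm p.1 * (φ).symm p.2) p :=
    ((hsymm _ h₁).comp p contDiff_fst.contMDiff.contMDiffAt).mul
      ((hsymm _ h₂).comp p contDiff_snd.contMDiff.contMDiffAt)
  exact (contMDiffAt_extChartAt' (by simpa using h₃)).comp p hmul

theorem mfderiv_one_eq_fderiv {f : G → E} (hf : MDifferentiableAt 𝓘(ℝ, E) 𝓘(ℝ, E) f 1) :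
    mfderiv 𝓘(ℝ, E) 𝓘(ℝ, E) f 1 = fderiv ℝ (fun q ↦ f ((φ).symm q)) (φ 1) := by
  rw [hf.mfderiv]
  simp only [ModelWithCorners.range_eq_univ, fderivWithin_univ]
  rfl

theorem mdifferentiableAt_extChartAt_one {x : G} (hx : x ∈ (φ).source) :
    MDifferentiableAt 𝓘(ℝ, E) 𝓘(ℝ, E) (φ) x :=
  (contMDiffAt_extChartAt' (n := 1) (by simpa using hx)).mdifferentiableAt (by simp)

/-- Left invariant fields in the chart are partial derivatives of the multiplication in its second
factor. -/
theorem fderiv_chartMul_right {p : E} (hp : p ∈ (φ).target) (v : E) :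
    fderiv ℝ (chartMul E G) (p, φ 1) (0, v) =
      mfderiv 𝓘(ℝ, E) 𝓘(ℝ, E) (φ) ((φ).symm p) (mulInvariantVectorField v ((φ).symm p)) := by
  have hx := (φ).map_target hp
  have hc : DifferentiableAt ℝ (chartMul E G) (p, φ 1) :=
    (contDiffAt_chartMul hp (mem_extChartAt_target 1)
      (by rwa [extChartAt_to_inv, mul_one])).differentiableAt (by simp)
  have hφ : MDifferentiableAt 𝓘(ℝ, E) 𝓘(ℝ, E) (φ) ((φ).symm p * 1) :=
    mdifferentiableAt_extChartAt_one (by rwa [mul_one])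
  have hmul := mdifferentiableAt_mul_left (E := E) ((φ).symm p) 1
  have h₁ := mfderiv_comp_apply (1 : G) hφ hmul v
  rw [mfderiv_one_eq_fderiv (hφ.comp (1 : G) hmul)] at h₁
  have h₂ : HasFDerivAt (fun q ↦ chartMul E G (p, q)) _ (φ 1) :=
    HasFDerivAt.comp (g := chartMul E G) (f := fun q ↦ (p, q)) (φ 1) hc.hasFDerivAt
      (hasFDerivAt_prodMk_right p (φ 1))
  have h₃ : fderiv ℝ (chartMul E G) (p, φ 1) (0, v) =
      fderiv ℝ (fun q ↦ chartMul E G (p, q)) (φ 1) v := by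
    rw [h₂.fderiv]; rfl
  rw [h₃]
  refine h₁.trans ?_
  have hbase : ∀ (b : G) (_ : b = (φ).symm p) (v : E),
      (mfderiv 𝓘(ℝ, E) 𝓘(ℝ, E) (φ) b v : E) = mfderiv 𝓘(ℝ, E) 𝓘(ℝ, E) (φ) ((φ).symm p) v := by
    rintro b rfl v; rfl
  exact hbase _ (mul_one _) _

theorem fderiv_chartMul_left {p : E} (hp : p ∈ (φ).target) (v : E) :
    fderiv ℝ (chartMul E G) (φ 1, p) (v, 0) =
      mfderiv 𝓘(ℝ, E) 𝓘(ℝ, E) (φ) (1 * (φ).symm p)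
        (mfderiv 𝓘(ℝ, E) 𝓘(ℝ, E) (fun y ↦ y * (φ).symm p) (1 : G) v) := by
  have hx := (φ).map_target hp
  have hc : DifferentiableAt ℝ (chartMul E G) (φ 1, p) :=
    (contDiffAt_chartMul (mem_extChartAt_target 1) hp
      (by rwa [extChartAt_to_inv, one_mul])).differentiableAt (by simp)
  have hφ : MDifferentiableAt 𝓘(ℝ, E) 𝓘(ℝ, E) (φ) (1 * (φ).symm p) :=
    mdifferentiableAt_extChartAt_one (by rwa [one_mul])
  have hmul := mdifferentiableAt_mul_right (E := E) ((φ).symm p) 1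
  have h₁ := mfderiv_comp_apply (1 : G) hφ hmul v
  rw [mfderiv_one_eq_fderiv (hφ.comp (1 : G) hmul)] at h₁
  have h₂ : HasFDerivAt (fun q ↦ chartMul E G (q, p)) _ (φ 1) :=
    HasFDerivAt.comp (g := chartMul E G) (f := fun q ↦ (q, p)) (φ 1) hc.hasFDerivAt
      (hasFDerivAt_prodMk_left (φ 1) p)
  have h₃ : fderiv ℝ (chartMul E G) (φ 1, p) (v, 0) =
      fderiv ℝ (fun q ↦ chartMul E G (q, p)) (φ 1) v := by
    rw [h₂.fderiv]; rfl
  rw [h₃]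
  exact h₁

/-- Left translation by x is conjugation by x followed by right translation by x. Differentiating
this relation in p will give the differential of Ad. -/
theorem fderiv_chartMul_Ad {p : E} (hp : p ∈ (φ).target) (v : E) :
    fderiv ℝ (chartMul E G) (φ 1, p) (Ad ((φ).symm p) v, 0) =
      fderiv ℝ (chartMul E G) (p, φ 1) (0, v) := by
  refine (fderiv_chartMul_left hp _).trans (Eq.trans ?_ (fderiv_chartMul_right hp v).symm)
  have h := mfderiv_comp_apply (I := 𝓘(ℝ, E)) (I' := 𝓘(ℝ, E)) (I'' := 𝓘(ℝ, E)) (1 : G)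
    (mdifferentiableAt_mul_right ((φ).symm p) ((φ).symm p * 1 * ((φ).symm p)⁻¹))
    (mdifferentiableAt_conj ((φ).symm p) 1) v
  have h' : (fun y : G ↦ y * (φ).symm p) ∘ (fun y : G ↦ (φ).symm p * y * ((φ).symm p)⁻¹) =
      fun y : G ↦ (φ).symm p * y := by
    ext; simp [mul_assoc]
  rw [h'] at h
  have hbase : ∀ (b c : G) (_ : b = 1) (_ : c = (φ).symm p) (v w : E),
      w = mfderiv 𝓘(ℝ, E) 𝓘(ℝ, E) (fun y ↦ y * (φ).symm p) b v →
      (mfderiv 𝓘(ℝ, E) 𝓘(ℝ, E) (φ) (1 * (φ).symm p)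
        (mfderiv 𝓘(ℝ, E) 𝓘(ℝ, E) (fun y ↦ y * (φ).symm p) 1 v) : E)
      = mfderiv 𝓘(ℝ, E) 𝓘(ℝ, E) (φ) c w := by
    rintro b c rfl hc v w rfl
    rw [hc, one_mul]
  exact hbase _ _ (by simp) rfl _ _ h

theorem differentiableAt_fderiv_chartMul :
    DifferentiableAt ℝ (fderiv ℝ (chartMul E G)) (φ 1, φ 1) :=
  ((contDiffAt_chartMul (mem_extChartAt_target 1) (mem_extChartAt_target 1)
    (by simp)).fderiv_right (m := 1) (by norm_cast)).differentiableAt (by simp)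

theorem fderiv_chartMul_one_left (v : E) : fderiv ℝ (chartMul E G) (φ 1, φ 1) (v, 0) = v := by
  have h₁ : HasFDerivAt (fun q ↦ chartMul E G (q, φ 1)) _ (φ 1) :=
    HasFDerivAt.comp (g := chartMul E G) (f := fun q ↦ (q, φ 1)) (φ 1)
      ((contDiffAt_chartMul (mem_extChartAt_target 1) (mem_extChartAt_target 1)
        (by simp)).differentiableAt (by simp)).hasFDerivAt (hasFDerivAt_prodMk_left (φ 1) (φ 1))
  have h₂ : (fun q ↦ chartMul E G (q, φ 1)) =ᶠ[nhds (φ 1)] id := by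
    filter_upwards [(isOpen_extChartAt_target (1 : G)).mem_nhds (mem_extChartAt_target 1)] with q hq
    simp only [chartMul, extChartAt_to_inv, mul_one, id]
    exact (φ).right_inv hq
  exact DFunLike.congr_fun (h₁.unique ((hasFDerivAt_id (φ 1)).congr_of_eventuallyEq h₂)) v

theorem fderiv_chartMul_one_right (v : E) : fderiv ℝ (chartMul E G) (φ 1, φ 1) (0, v) = v := by
  have h₁ : HasFDerivAt (fun q ↦ chartMul E G (φ 1, q)) _ (φ 1) :=
    HasFDerivAt.comp (g := chartMul E G) (f := fun q ↦ (φ 1, q)) (φ 1)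
      ((contDiffAt_chartMul (mem_extChartAt_target 1) (mem_extChartAt_target 1)
        (by simp)).differentiableAt (by simp)).hasFDerivAt (hasFDerivAt_prodMk_right (φ 1) (φ 1))
  have h₂ : (fun q ↦ chartMul E G (φ 1, q)) =ᶠ[nhds (φ 1)] id := by
    filter_upwards [(isOpen_extChartAt_target (1 : G)).mem_nhds (mem_extChartAt_target 1)] with q hq
    simp only [chartMul, extChartAt_to_inv, one_mul, id]
    exact (φ).right_inv hq
  exact DFunLike.congr_fun (h₁.unique ((hasFDerivAt_id (φ 1)).congr_of_eventuallyEq h₂)) v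

theorem hasFDerivAt_fderiv_chartMul_left (u : E × E) :
    HasFDerivAt (fun p ↦ fderiv ℝ (chartMul E G) (p, φ 1) u)
      (((ContinuousLinearMap.apply ℝ E u).comp
        (fderiv ℝ (fderiv ℝ (chartMul E G)) (φ 1, φ 1))).comp (ContinuousLinearMap.inl ℝ E E))
      (φ 1) :=
  ((ContinuousLinearMap.apply ℝ E u).hasFDerivAt).comp (φ 1)
    (HasFDerivAt.comp (g := fderiv ℝ (chartMul E G)) (f := fun q ↦ (q, φ 1)) (φ 1)
      differentiableAt_fderiv_chartMul.hasFDerivAt (hasFDerivAt_prodMk_left (φ 1) (φ 1)))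

/-- By `fderiv_chartMul_right`, the derivative at the identity of a left invariant field is a mixed
second derivative of the multiplication m; the bracket of fields antisymmetrizes it. -/
theorem lie_eq_fderiv_chartMul [FiniteDimensional ℝ E] (v w : GroupLieAlgebra 𝓘(ℝ, E) G) :
    ⁅v, w⁆ = fderiv ℝ (fderiv ℝ (chartMul E G)) (φ 1, φ 1) (v, 0) (0, w) -
      fderiv ℝ (fderiv ℝ (chartMul E G)) (φ 1, φ 1) (w, 0) (0, v) := by
  have hfield : ∀ u : GroupLieAlgebra 𝓘(ℝ, E) G,
      mpullbackWithin 𝓘(ℝ, E) 𝓘(ℝ, E) (φ).symm (mulInvariantVectorField u) (Set.range 𝓘(ℝ, E))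
        =ᶠ[nhds (φ 1)] fun p ↦ fderiv ℝ (chartMul E G) (p, φ 1) (0, u) := by
    intro u
    filter_upwards [(isOpen_extChartAt_target (1 : G)).mem_nhds (mem_extChartAt_target 1)] with p hp
    refine Eq.trans ?_ (fderiv_chartMul_right hp u).symm
    rw [mpullbackWithin_apply,
      ContinuousLinearMap.inverse_eq (mfderivWithin_extChartAt_symm_comp_mfderiv_extChartAt hp)
      (mfderiv_extChartAt_comp_mfderivWithin_extChartAt_symm hp)]
    rfl
  have hid : (mfderiv 𝓘(ℝ, E) 𝓘(ℝ, E) (φ) 1 : E →L[ℝ] E) = ContinuousLinearMap.id ℝ E :=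
    mfderiv_extChartAt_self
  have hinv : ∀ z : E, (mfderiv 𝓘(ℝ, E) 𝓘(ℝ, E) (φ) 1).inverse z = z := by
    intro z
    have aux : ∀ L : E →L[ℝ] E, L = ContinuousLinearMap.id ℝ E → L.inverse z = z := by
      rintro L rfl; simp
    exact aux _ hid
  have hbracket : ∀ V W V' W' : E → E, V =ᶠ[nhds (φ 1)] V' → W =ᶠ[nhds (φ 1)] W' →
      lieBracketWithin ℝ V W Set.univ (φ 1) =
        fderiv ℝ W' (φ 1) (V' (φ 1)) - fderiv ℝ V' (φ 1) (W' (φ 1)) := by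
    intro V W V' W' hV hW
    rw [lieBracketWithin_univ, hV.lieBracket_vectorField_eq hW, lieBracket]
  rw [GroupLieAlgebra.bracket_def, ← mlieBracketWithin_univ, mlieBracketWithin_apply]
  refine (hinv _).trans ?_
  simp only [Set.preimage_univ, Set.univ_inter, ModelWithCorners.range_eq_univ] at hfield ⊢
  refine (hbracket _ _ _ _ (hfield v) (hfield w)).trans ?_
  have hv := fderiv_chartMul_one_right (E := E) (G := G) v
  have hw := fderiv_chartMul_one_right (E := E) (G := G) w
  have hv' := (hasFDerivAt_fderiv_chartMul_left (G := G) ((0, v) : E × E)).fderiv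
  have hw' := (hasFDerivAt_fderiv_chartMul_left (G := G) ((0, w) : E × E)).fderiv
  refine congrArg₂ (fun a b : E ↦ a - b) ?_ ?_
  · exact (congrArg _ hv).trans (DFunLike.congr_fun hw' (v : E))
  · exact (congrArg _ hw).trans (DFunLike.congr_fun hv' (w : E))

theorem hasFDerivAt_fderiv_chartMul_right :
    HasFDerivAt (fun p ↦ (fderiv ℝ (chartMul E G) (φ 1, p)).comp (ContinuousLinearMap.inl ℝ E E))
      ((((ContinuousLinearMap.compL ℝ E (E × E) E).flip (ContinuousLinearMap.inl ℝ E E)).comp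
        (fderiv ℝ (fderiv ℝ (chartMul E G)) (φ 1, φ 1))).comp (ContinuousLinearMap.inr ℝ E E))
      (φ 1) :=
  (((ContinuousLinearMap.compL ℝ E (E × E) E).flip
    (ContinuousLinearMap.inl ℝ E E)).hasFDerivAt).comp (φ 1)
    (HasFDerivAt.comp (g := fderiv ℝ (chartMul E G)) (f := fun q ↦ (φ 1, q)) (φ 1)
      differentiableAt_fderiv_chartMul.hasFDerivAt (hasFDerivAt_prodMk_right (φ 1) (φ 1)))

theorem Ad_one (v : GroupLieAlgebra 𝓘(ℝ, E) G) : Ad (1 : G) v = v := by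
  have h : (fun y : G ↦ 1 * y * 1⁻¹) = id := by ext; simp
  rw [Ad_apply, h, mfderiv_id]
  rfl

variable [FiniteDimensional ℝ E]

/-- The differential at the identity of the adjoint representation, in the preferred chart, is the
adjoint representation of the Lie algebra. -/
theorem hasFDerivAt_Ad (w : GroupLieAlgebra 𝓘(ℝ, E) G) :
    ∃ L : E →L[ℝ] E, (∀ v : GroupLieAlgebra 𝓘(ℝ, E) G, L v = ⁅v, w⁆) ∧
      HasFDerivAt (fun p : E ↦ (Ad ((φ).symm p) w : E)) L (φ 1) := by
  -- P p is the differential of right translation by p and Q p the value at p of the left invariant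
  -- field of w, so P p (Ad_p w) = Q p near the identity.
  let P : E → E →L[ℝ] E :=
    fun p ↦ (fderiv ℝ (chartMul E G) (φ 1, p)).comp (ContinuousLinearMap.inl ℝ E E)
  let Q : E → E := fun p ↦ fderiv ℝ (chartMul E G) (p, φ 1) (0, w)
  let f : E → E := fun p ↦ Ad ((φ).symm p) w
  have hP : HasFDerivAt P _ (φ 1) := hasFDerivAt_fderiv_chartMul_right
  have hQ : HasFDerivAt Q _ (φ 1) := hasFDerivAt_fderiv_chartMul_left ((0, w) : E × E)
  have hP1 : P (φ 1) = ContinuousLinearEquiv.refl ℝ E := by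
    ext v; exact fderiv_chartMul_one_left v
  have hf1 : f (φ 1) = w := by
    simp only [f, extChartAt_to_inv]; exact Ad_one w
  have hPf : (fun p ↦ P p (f p)) =ᶠ[nhds (φ 1)] Q := by
    filter_upwards [(isOpen_extChartAt_target (1 : G)).mem_nhds (mem_extChartAt_target 1)] with p hp
    exact fderiv_chartMul_Ad hp w
  -- P is the identity at the base point, hence invertible nearby, and f = P⁻¹Q there.
  have hf : DifferentiableAt ℝ f (φ 1) := by
    have hinv : DifferentiableAt ℝ (fun p ↦ (P p).inverse (Q p)) (φ 1) := by
      refine DifferentiableAt.clm_apply ?_ hQ.differentiableAt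
      refine DifferentiableAt.comp (g := ContinuousLinearMap.inverse) (f := P) (φ 1) ?_ hP.differentiableAt
      rw [hP1]
      exact (contDiffAt_map_inverse (n := 1) (ContinuousLinearEquiv.refl ℝ E)).differentiableAt
        (by simp)
    refine hinv.congr_of_eventuallyEq ?_
    have hopen := hP.continuousAt (by rw [hP1]; exact ContinuousLinearEquiv.nhds _)
    filter_upwards [hPf, hopen] with p hp ⟨e, he⟩
    rw [← hp, ← he]
    simp
  -- The product rule gives D²m(0,v)(w,0) + f'(v) = D²m(v,0)(0,w); symmetry of D²m turns this into
  -- the bracket formula.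
  have hmul := (hP.clm_apply hf.hasFDerivAt).unique (hQ.congr_of_eventuallyEq hPf)
  refine ⟨fderiv ℝ f (φ 1), fun v ↦ ?_, hf.hasFDerivAt⟩
  have hv := DFunLike.congr_fun hmul (v : E)
  rw [hf1, hP1] at hv
  have hsymm : IsSymmSndFDerivAt ℝ (chartMul E G) (φ 1, φ 1) :=
    ContDiffAt.isSymmSndFDerivAt (n := ∞) (contDiffAt_chartMul (mem_extChartAt_target 1)
      (mem_extChartAt_target 1) (by simp)) (by simpa using! ENat.LEInfty.out)
  rw [lie_eq_fderiv_chartMul]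
  have hs := hsymm.eq ((0, v) : E × E) ((w, 0) : E × E)
  have hv' : fderiv ℝ f (φ 1) v + fderiv ℝ (fderiv ℝ (chartMul E G)) (φ 1, φ 1)
      ((0, v) : E × E) ((w, 0) : E × E) = fderiv ℝ (fderiv ℝ (chartMul E G)) (φ 1, φ 1)
      ((v, 0) : E × E) ((0, w) : E × E) := hv
  rw [hs] at hv'
  exact eq_sub_of_add_eq hv'

/-- The scalar product of a bi-invariant metric is invariant under the adjoint representation. -/
theorem scalarProduct_lie {g : ContMDiffRiemannianMetric 𝓘(ℝ, E) ∞ E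
    (fun x : G ↦ TangentSpace 𝓘(ℝ, E) x)} (hg : IsBiInvariant g)
    (u v w : GroupLieAlgebra 𝓘(ℝ, E) G) :
    scalarProduct g ⁅u, v⁆ w = - scalarProduct g v ⁅u, w⁆ := by
  obtain ⟨L, hL, hv⟩ := hasFDerivAt_Ad v
  obtain ⟨M, hM, hw⟩ := hasFDerivAt_Ad w
  let b : E →L[ℝ] E →L[ℝ] ℝ := g.inner (1 : G)
  -- The function p ↦ ⟨Ad_p v, Ad_p w⟩ is constant, so its derivative vanishes.
  have h := (b.hasFDerivAt_of_bilinear hv hw).unique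
    ((hasFDerivAt_const (scalarProduct g v w) (φ 1)).congr_of_eventuallyEq
      (Filter.Eventually.of_forall fun p ↦ inner_Ad_Ad hg ((φ).symm p) v w))
  have hu := DFunLike.congr_fun h (u : E)
  have hv1 : Ad ((φ).symm (φ 1)) v = v := by rw [extChartAt_to_inv, Ad_one]
  have hw1 : Ad ((φ).symm (φ 1)) w = w := by rw [extChartAt_to_inv, Ad_one]
  have hu' : scalarProduct g (Ad ((φ).symm (φ 1)) v) (M u) +
      scalarProduct g (L u) (Ad ((φ).symm (φ 1)) w) = 0 := hu
  rw [hv1, hw1, hL, hM] at hu'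
  linarith

/-- The Lie algebra of the image of a commutative Lie group is abelian. -/
theorem lie_differential_eq_zero {F : Type*} [NormedAddCommGroup F] [NormedSpace ℝ F]
    {H : Type*} [TopologicalSpace H] [ChartedSpace F H] [CommGroup H] [LieGroup 𝓘(ℝ, F) ∞ H]
    (i : H →* G) (hi : ContMDiff 𝓘(ℝ, F) 𝓘(ℝ, E) ∞ i) (v w : GroupLieAlgebra 𝓘(ℝ, F) H) :
    ⁅differential (E := E) i v, differential (E := E) i w⁆ = 0 := by
  have hi1 : MDifferentiableAt 𝓘(ℝ, F) 𝓘(ℝ, E) i 1 := hi.mdifferentiableAt (by simp)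
  have hAd : ∀ x : H, Ad (i x) (differential (E := E) i w) = differential (E := E) i w := by
    intro x
    have hconj := mdifferentiableAt_conj (E := E) (i x) (i 1)
    have h := mfderiv_comp_apply (1 : H) hconj hi1 w
    have h' : (fun y : G ↦ i x * y * (i x)⁻¹) ∘ i = i := by
      ext y; simp [← map_mul, ← map_inv, mul_comm x y]
    rw [h'] at h
    have hbase : ∀ (b : G) (_ : b = 1) (v w : E),
        w = mfderiv 𝓘(ℝ, E) 𝓘(ℝ, E) (fun y : G ↦ i x * y * (i x)⁻¹) b v → Ad (i x) v = w := by
      rintro b rfl v w rfl; rfl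
    exact hbase _ (map_one i) _ _ h
  obtain ⟨L, hL, hw⟩ := hasFDerivAt_Ad (differential (E := E) i w)
  have hφ : MDifferentiableAt 𝓘(ℝ, E) 𝓘(ℝ, E) (φ) 1 :=
    mdifferentiableAt_extChartAt_one (mem_extChartAt_source 1)
  let f : E → E := fun p ↦ Ad ((φ).symm p) (differential (E := E) i w)
  have hf : MDifferentiableAt 𝓘(ℝ, E) 𝓘(ℝ, E) f (φ 1) :=
    mdifferentiableAt_iff_differentiableAt.2 hw.differentiableAt
  have hfL : fderiv ℝ f (φ 1) = L := HasFDerivAt.fderiv hw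
  have hcomp : ∀ u : E, mfderiv 𝓘(ℝ, E) 𝓘(ℝ, E) (f ∘ φ) (1 : G) u = L u := by
    intro u
    refine (mfderiv_comp_apply (1 : G) hf hφ u).trans ?_
    rw [mfderiv_eq_fderiv, mfderiv_extChartAt_self]
    exact DFunLike.congr_fun hfL u
  obtain ⟨c, hc⟩ : ∃ c : E, c = differential (E := E) i w := ⟨_, rfl⟩
  -- By commutativity Ad fixes di(w) along the image of i. The chain rule then makes the derivative
  -- of Ad kill di(w) in the direction di(v).
  have hconst : (f ∘ φ) ∘ i =ᶠ[nhds (1 : H)] fun _ ↦ c := by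
    have hmem : i ⁻¹' (φ).source ∈ nhds (1 : H) := by
      refine hi.continuous.continuousAt.preimage_mem_nhds ?_
      rw [map_one]
      exact extChartAt_source_mem_nhds (1 : G)
    filter_upwards [hmem] with x hx
    rw [hc, ← hAd x, ← (φ).left_inv hx]
    rfl
  have h := mfderiv_comp_apply_of_eq (I'' := 𝓘(ℝ, E)) (x := (1 : H)) (hf.comp (1 : G) hφ) hi1
    (map_one i) v
  rw [hconst.mfderiv_eq, mfderiv_const] at h
  rw [← hL]
  exact (h.trans (hcomp _)).symm

end Adjoint

/-! ### Norms of 2-tensors, and the connection of the twisted bracket. -/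

section Twist

open Module (End)
open LieAlgebra (ad)

/-- The square of the norm of a symmetric `2`-tensor is the trace of the square of the
corresponding self-adjoint operator. -/
theorem tensorNormSq_eq_trace {V : Type*} [AddCommGroup V] [Module ℝ V] [FiniteDimensional ℝ V]
    {B : LinearMap.BilinForm ℝ V} (hB : B.Nondegenerate) (hs : B.IsSymm) {b : V → V → ℝ}
    (R : End ℝ V) (hb : ∀ X Y, b X Y = B (R X) Y) (hR : ∀ X Y, B (R X) Y = B X (R Y)) :
    tensorNormSq B b = LinearMap.trace ℝ V (R * R) := by
  set e := Module.finBasis ℝ V with he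
  set C : Matrix _ _ ℝ := Matrix.of fun i j ↦ B (e i) (e j) with hC
  set M := LinearMap.toMatrix e e R with hM
  have hCB : C = LinearMap.BilinForm.toMatrix e B := by
    ext i j; simp [hC]
  have hdet : IsUnit C.det := by
    rw [hCB]
    exact ((LinearMap.BilinForm.nondegenerate_iff_det_ne_zero e).1 hB).isUnit
  -- With Gram matrix C, raising one index of b gives the matrix M of R; the fourfold sum then
  -- collapses to tr M².
  have hCM : (Matrix.of fun i j ↦ b (e i) (e j)) = C * M := by
    ext i j
    have : R (e j) = ∑ k, M k j • e k := by
      rw [← e.sum_repr (R (e j))]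
      simp [hM, LinearMap.toMatrix_apply]
    simp [hb, hR, this, Matrix.mul_apply, hC, mul_comm]
  have hQM : C⁻¹ * (Matrix.of fun i j ↦ b (e i) (e j)) = M := by
    rw [hCM, ← mul_assoc, Matrix.nonsing_inv_mul C hdet, one_mul]
  have hM' : ∀ i j, M i j = ∑ k, C⁻¹ i k * b (e k) (e j) := by
    intro i j
    rw [← hQM, Matrix.mul_apply]
    rfl
  have hQ : ∀ i j, C⁻¹ i j = C⁻¹ j i := by
    have hsymm : C.transpose = C := by ext i j; exact hs.eq _ _
    intro i j
    conv_lhs => rw [← hsymm, ← Matrix.transpose_nonsing_inv]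
    rfl
  have hbs : ∀ X Y, b X Y = b Y X := fun X Y ↦ by rw [hb, hb, hR, hs.eq]
  have hMM : LinearMap.trace ℝ V (R * R) = ∑ k, ∑ j, M k j * M j k := by
    rw [LinearMap.trace_eq_matrix_trace ℝ e, LinearMap.toMatrix_mul]
    simp [Matrix.trace, Matrix.mul_apply, hM]
  rw [hMM]
  calc tensorNormSq B b
      = ∑ i, ∑ j, ∑ k, ∑ l, C⁻¹ i k * C⁻¹ j l * b (e i) (e j) * b (e k) (e l) := rfl
    _ = ∑ k, ∑ j, ∑ i, ∑ l, C⁻¹ i k * C⁻¹ j l * b (e i) (e j) * b (e k) (e l) := by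
        rw [Finset.sum_congr rfl fun i _ ↦ Finset.sum_comm, Finset.sum_comm]
        exact Finset.sum_congr rfl fun k _ ↦ Finset.sum_comm
    _ = ∑ k, ∑ j, M k j * M j k := by
        refine Finset.sum_congr rfl fun k _ ↦ Finset.sum_congr rfl fun j _ ↦ ?_
        rw [hM', hM', Finset.sum_mul_sum]
        refine Finset.sum_congr rfl fun i _ ↦ Finset.sum_congr rfl fun l _ ↦ ?_
        rw [hQ i k, hbs (e k) (e l)]
        ring

variable {V : Type*} [LieRing V] [LieAlgebra ℝ V]

/-- A linear map `l` into an abelian subspace `h` of a metric Lie algebra, with transpose `j`, that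
vanishes on `h` and on `[h, V]`. -/
structure IsTwist (B : LinearMap.BilinForm ℝ V) (h : Submodule ℝ V) (l j : End ℝ V) : Prop where
  nondegenerate : B.Nondegenerate
  isSymm : B.IsSymm
  invariant : ∀ u v w : V, B ⁅u, v⁆ w = - B v ⁅u, w⁆
  abelian : ∀ u ∈ h, ∀ v ∈ h, ⁅(u : V), v⁆ = 0
  map_mem : ∀ u, l u ∈ h
  map_eq_zero : ∀ u ∈ h, l u = 0
  map_lie : ∀ u ∈ h, ∀ v : V, l ⁅u, v⁆ = 0
  adjoint : ∀ u v, B (j u) v = B u (l v)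

/-- The Levi-Civita connection of the scalar product `B` on `V` for the Lie bracket obtained from
`⁅·, ·⁆` by conjugation with `1 + l`. -/
noncomputable def twistConnection (l j : End ℝ V) : V →ₗ[ℝ] V →ₗ[ℝ] V :=
  LinearMap.mk₂ ℝ (fun X Y ↦ (1 / 2 : ℝ) • (⁅X, Y⁆ - ⁅j X, Y⁆ + l ⁅X, Y⁆ + ⁅X, j Y⁆) - ⁅l X, Y⁆)
    (by intros; simp only [map_add, add_lie]; module)
    (by intros; simp only [map_smul, smul_lie]; module)
    (by intros; simp only [map_add, lie_add]; module)
    (by intros; simp only [map_smul, lie_smul]; module)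

theorem twistConnection_apply (l j : End ℝ V) (X Y : V) : twistConnection l j X Y =
    (1 / 2 : ℝ) • (⁅X, Y⁆ - ⁅j X, Y⁆ + l ⁅X, Y⁆ + ⁅X, j Y⁆) - ⁅l X, Y⁆ := rfl

theorem twistConnection_flip (l j : End ℝ V) (W : V) : (twistConnection l j).flip W =
    -(1 / 2 : ℝ) • ad ℝ V (W + j W) + (1 / 2 : ℝ) • (ad ℝ V W * j) - (1 / 2 : ℝ) • (l * ad ℝ V W)
      + ad ℝ V W * l := by
  ext X
  simp only [LinearMap.flip_apply, twistConnection_apply, LinearMap.add_apply, LinearMap.sub_apply,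
    LinearMap.smul_apply, Module.End.mul_apply, LieAlgebra.ad_apply, add_lie]
  rw [← lie_skew X W, ← lie_skew (j X) W, ← lie_skew X (j W), ← lie_skew (l X) W, map_neg]
  module

theorem twistConnection_conj_flip (l j : End ℝ V) (W : V) :
    (((twistConnection l j).compl₁₂ (1 + l) (1 + l)).compr₂ (1 - l)).flip W =
      (1 - l) * (twistConnection l j).flip ((1 + l) W) * (1 + l) := rfl

namespace IsTwist

variable {B : LinearMap.BilinForm ℝ V} {h : Submodule ℝ V} {l j : End ℝ V}

theorem cyclic (H : IsTwist B h l j) (u v w : V) : B ⁅u, v⁆ w = B ⁅v, w⁆ u := by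
  rw [H.isSymm.eq ⁅v, w⁆ u, ← lie_skew u v, map_neg, LinearMap.neg_apply, H.invariant]
  simp

theorem swap (H : IsTwist B h l j) (u v w : V) : B ⁅u, v⁆ w = - B ⁅u, w⁆ v := by
  rw [H.invariant, H.isSymm.eq]

theorem adjoint' (H : IsTwist B h l j) (u v : V) : B (l u) v = B u (j v) := by
  rw [H.isSymm.eq (l u), ← H.adjoint, H.isSymm.eq]

theorem map_lie' (H : IsTwist B h l j) {u : V} (hu : u ∈ h) (v : V) : l ⁅v, u⁆ = 0 := by
  rw [← lie_skew, map_neg, H.map_lie u hu, neg_zero]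

theorem eq_of_forall (H : IsTwist B h l j) {u v : V} (huv : ∀ w, B u w = B v w) : u = v := by
  rw [← sub_eq_zero]
  exact H.nondegenerate.1 _ fun w ↦ by rw [map_sub, LinearMap.sub_apply, huv, sub_self]

/-- This is the dual of `map_lie`: by skewness, pairing with w gives -B(v, l[u,w]) = 0. -/
theorem lie_adjoint (H : IsTwist B h l j) {u : V} (hu : u ∈ h) (v : V) : ⁅u, j v⁆ = 0 := by
  refine H.eq_of_forall fun w ↦ ?_
  rw [H.invariant, H.adjoint, H.map_lie u hu]
  simp

theorem adjoint_lie (H : IsTwist B h l j) {u : V} (hu : u ∈ h) (v : V) : ⁅j v, u⁆ = 0 := by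
  rw [← lie_skew, H.lie_adjoint hu, neg_zero]

theorem map_map (H : IsTwist B h l j) (u : V) : l (l u) = 0 := H.map_eq_zero _ (H.map_mem u)

theorem one_add_mul_one_sub (H : IsTwist B h l j) : (1 + l) * (1 - l) = 1 := by
  ext u; simp [H.map_map]

/-- Put x = (1+l)u and y = (1+l)v: the right side is the bracket transported by 1 + l, because l
kills [h,V] and h is abelian. -/
theorem one_add_lie (H : IsTwist B h l j) (u v : V) : ⁅u, v⁆ + l ⁅u, v⁆ =
    ⁅u + l u, v + l v⁆ + l ⁅u + l u, v + l v⁆ - ⁅l (u + l u), v + l v⁆ - ⁅u + l u, l (v + l v)⁆ := by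
  simp only [map_add, H.map_map, add_lie, lie_add, H.abelian _ (H.map_mem u) _ (H.map_mem v),
    H.map_lie _ (H.map_mem u), H.map_lie' (H.map_mem v), add_zero]
  abel

/-- Koszul's formula for B and the twisted bracket, solved for the vector paired with w by moving ad
and l across B. -/
theorem koszul_twistConnection (H : IsTwist B h l j) (x y w : V) :
    B (twistConnection l j x y) w =
      1 / 2 * (B (⁅x, y⁆ + l ⁅x, y⁆ - ⁅l x, y⁆ - ⁅x, l y⁆) w
        - B (⁅x, w⁆ + l ⁅x, w⁆ - ⁅l x, w⁆ - ⁅x, l w⁆) y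
        - B (⁅y, w⁆ + l ⁅y, w⁆ - ⁅l y, w⁆ - ⁅y, l w⁆) x) := by
  simp only [twistConnection_apply, map_add, map_sub, map_smul, LinearMap.add_apply,
    LinearMap.sub_apply, LinearMap.smul_apply, smul_eq_mul, H.adjoint']
  have e₁ := H.swap x w y
  have e₂ := H.cyclic x y w
  have e₃ := H.swap x w (j y)
  have e₄ := H.swap (l x) w y
  have e₅ := H.swap x (l w) y
  have e₆ := H.cyclic (j x) y w
  have e₇ := H.cyclic x (l y) w
  have e₈ := H.cyclic x y (l w)
  linarith

/-- The connection of the scalar product `(1 + l)^* B`. -/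
theorem koszul_pullbackForm (H : IsTwist B h l j) (X Y W : V) :
    pullbackForm B l (((twistConnection l j).compl₁₂ (1 + l) (1 + l)).compr₂ (1 - l) X Y) W =
      1 / 2 * (pullbackForm B l ⁅X, Y⁆ W - pullbackForm B l ⁅X, W⁆ Y
        - pullbackForm B l ⁅Y, W⁆ X) := by
  have h₁ : ∀ u v, pullbackForm B l u v = B (u + l u) (v + l v) := fun u v ↦ rfl
  have h₂ : ∀ u, (1 - l) u + l ((1 - l) u) = u := fun u ↦ by simp [H.map_map]
  have h₃ : ∀ u, (1 + l) u = u + l u := fun u ↦ rfl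
  simp only [h₁, LinearMap.compr₂_apply, LinearMap.compl₁₂_apply, h₂, h₃]
  rw [H.koszul_twistConnection, H.one_add_lie X Y, H.one_add_lie X W, H.one_add_lie Y W]

theorem isSymm_pullbackForm (H : IsTwist B h l j) : (pullbackForm B l).IsSymm :=
  ⟨fun _ _ ↦ H.isSymm.eq _ _⟩

theorem nondegenerate_pullbackForm (H : IsTwist B h l j) : (pullbackForm B l).Nondegenerate := by
  refine H.isSymm_pullbackForm.isRefl.nondegenerate_iff_separatingLeft.mpr ?_
  intro u hu
  have hu' : u + l u = 0 := H.nondegenerate.1 _ fun w ↦ by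
    have := hu ((1 - l) w)
    have h₁ : pullbackForm B l u ((1 - l) w) = B (u + l u) ((1 - l) w + l ((1 - l) w)) := rfl
    rw [h₁] at this
    simpa [H.map_map] using this
  have := congrArg l hu'
  rw [map_add, H.map_map, map_zero, add_zero] at this
  rwa [this, add_zero] at hu'

end IsTwist
end Twist

/-! ### Traces of the connection and the Ricci operator. -/

section TwistRicci

open Module (End)
open LieAlgebra (ad)

variable {V : Type*} [LieRing V] [LieAlgebra ℝ V]

theorem trace_smulRight_sum [FiniteDimensional ℝ V] {ι : Type*} [Fintype ι]
    {T : End ℝ V} {f : ι → Module.Dual ℝ V} {v : ι → V} (hT : ∀ X, T X = ∑ k, f k X • v k)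
    (M : End ℝ V) : LinearMap.trace ℝ V (M * T) = ∑ k, f k (M (v k)) := by
  have h : M * T = ∑ k, (f k).smulRight (M (v k)) := by
    ext X; simp [hT]
  rw [h, map_sum]
  simp [LinearMap.trace_smulRight]

namespace IsTwist

variable {B : LinearMap.BilinForm ℝ V} {h : Submodule ℝ V} {l j : End ℝ V}
  {ι : Type*} [Fintype ι] {Z : ι → V}

theorem map_eq_sum (H : IsTwist B h l j) (hexp : ∀ u ∈ h, u = ∑ k, B (Z k) u • Z k) (X : V) :
    l X = ∑ k, B (j (Z k)) X • Z k := by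
  conv_lhs => rw [hexp _ (H.map_mem X)]
  simp only [H.adjoint]

theorem adjoint_eq_sum (H : IsTwist B h l j) (hexp : ∀ u ∈ h, u = ∑ k, B (Z k) u • Z k) (X : V) :
    j X = ∑ k, B (Z k) X • j (Z k) := by
  refine H.eq_of_forall fun w ↦ ?_
  rw [H.adjoint, H.map_eq_sum hexp w]
  simp only [map_sum, map_smul, LinearMap.sum_apply, LinearMap.smul_apply, smul_eq_mul]
  exact Finset.sum_congr rfl fun k _ ↦ by rw [H.isSymm.eq X, mul_comm]

/-- The Ricci operator is built from these two operators and the Killing form. -/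
noncomputable def squareSum (j : End ℝ V) (Z : ι → V) : End ℝ V :=
  ∑ k, ad ℝ V (j (Z k)) * ad ℝ V (j (Z k))

/-- See `squareSum`. -/
noncomputable def mixedSum (j : End ℝ V) (Z : ι → V) : End ℝ V :=
  ∑ k, ad ℝ V (Z k) * ad ℝ V (j (Z k))

theorem apply_ad_ad (H : IsTwist B h l j) (u v x y : V) :
    B u (ad ℝ V x (ad ℝ V y v)) = B (ad ℝ V v (ad ℝ V u x)) y := by
  simp only [LieAlgebra.ad_apply]
  rw [H.isSymm.eq u, H.invariant, H.invariant v, ← lie_skew u x, ← lie_skew v y, map_neg B,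
    LinearMap.neg_apply, map_neg, neg_neg, H.isSymm.eq]

theorem apply_ad_ad' (H : IsTwist B h l j) (u v x y : V) :
    B (ad ℝ V v (ad ℝ V u x)) y = B x (ad ℝ V u (ad ℝ V v y)) := by
  simp only [LieAlgebra.ad_apply]
  rw [H.invariant, H.invariant, neg_neg]

theorem ad_comm (H : IsTwist B h l j) {u : V} (hu : u ∈ h) (v : V) :
    ad ℝ V u * ad ℝ V (j v) = ad ℝ V (j v) * ad ℝ V u := by
  ext X
  simp only [Module.End.mul_apply, LieAlgebra.ad_apply]
  rw [leibniz_lie, H.lie_adjoint hu, zero_lie, zero_add]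

theorem isSymm_squareSum (H : IsTwist B h l j) (x y : V) :
    B (squareSum j Z x) y = B x (squareSum j Z y) := by
  simp only [squareSum, LinearMap.sum_apply, Module.End.mul_apply, map_sum]
  exact Finset.sum_congr rfl fun k _ ↦ H.apply_ad_ad' _ _ _ _

theorem isSymm_mixedSum (H : IsTwist B h l j) (hZ : ∀ k, Z k ∈ h) (x y : V) :
    B (mixedSum j Z x) y = B x (mixedSum j Z y) := by
  simp only [mixedSum, LinearMap.sum_apply, map_sum]
  refine Finset.sum_congr rfl fun k _ ↦ ?_
  rw [Module.End.mul_apply, H.apply_ad_ad', ← Module.End.mul_apply, H.ad_comm (hZ k)]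

/-- Moving the outer j across B leaves a bracket of j u with an element of h, which is zero. The
analogous products with l likewise vanish. -/
theorem adjoint_mul_ad_mul_adjoint (H : IsTwist B h l j) (X : V) : j * ad ℝ V X * j = 0 := by
  ext u
  refine H.eq_of_forall fun w ↦ ?_
  simp only [Module.End.mul_apply, LieAlgebra.ad_apply, LinearMap.zero_apply, map_zero]
  rw [H.adjoint, H.cyclic, H.adjoint_lie (H.map_mem w)]
  simp

theorem map_mul_ad_mul_map (H : IsTwist B h l j) (X : V) : l * ad ℝ V X * l = 0 := by
  ext u
  simp [H.map_lie' (H.map_mem u)]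

theorem adjoint_mul_ad_mul_map (H : IsTwist B h l j) (X : V) : j * ad ℝ V X * l = 0 := by
  ext u
  refine H.eq_of_forall fun w ↦ ?_
  simp only [Module.End.mul_apply, LieAlgebra.ad_apply, LinearMap.zero_apply, map_zero]
  rw [H.adjoint, H.cyclic, H.abelian _ (H.map_mem u) _ (H.map_mem w)]
  simp

theorem map_mul_map (H : IsTwist B h l j) : l * l = 0 := by
  ext u; simp [H.map_map]

theorem apply_conj (H : IsTwist B h l j) (K : End ℝ V) (u v : V) :
    B (((1 + l) * K * (1 + j)) u) v = B (K (u + j u)) (v + j v) := by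
  simp only [Module.End.mul_apply, LinearMap.add_apply, Module.End.one_apply]
  rw [map_add (B (K (u + j u))), map_add B, LinearMap.add_apply, H.adjoint']

variable [FiniteDimensional ℝ V]

/-- Skewness for B makes the dual map of ad conjugate to -ad, so the trace equals its own negative.
-/
theorem trace_ad (H : IsTwist B h l j) (X : V) : LinearMap.trace ℝ V (ad ℝ V X) = 0 := by
  have hd : Module.Dual.transpose (R := ℝ) (ad ℝ V X) =
      (B.toDual H.nondegenerate).conj (-(ad ℝ V X)) := by
    ext f u
    obtain ⟨v, rfl⟩ := (B.toDual H.nondegenerate).surjective f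
    simp only [LinearEquiv.conj_apply_apply, LinearEquiv.symm_apply_apply,
      Module.Dual.transpose_apply, LinearMap.comp_apply, LinearMap.BilinForm.toDual_def,
      LinearMap.neg_apply, map_neg, LieAlgebra.ad_apply]
    rw [H.invariant, neg_neg]
  have h₁ := LinearMap.trace_transpose' (ad ℝ V X)
  rw [hd, LinearMap.trace_conj', map_neg] at h₁
  linarith

theorem trace_mul_map (H : IsTwist B h l j) (hexp : ∀ u ∈ h, u = ∑ k, B (Z k) u • Z k)
    (M : End ℝ V) : LinearMap.trace ℝ V (M * l) = ∑ k, B (j (Z k)) (M (Z k)) :=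
  trace_smulRight_sum (H.map_eq_sum hexp) M

theorem trace_mul_adjoint (H : IsTwist B h l j) (hexp : ∀ u ∈ h, u = ∑ k, B (Z k) u • Z k)
    (M : End ℝ V) : LinearMap.trace ℝ V (M * j) = ∑ k, B (Z k) (M (j (Z k))) :=
  trace_smulRight_sum (H.adjoint_eq_sum hexp) M

theorem trace_ad_mul_map (H : IsTwist B h l j) (hexp : ∀ u ∈ h, u = ∑ k, B (Z k) u • Z k)
    (hZ : ∀ k, Z k ∈ h) (X : V) : LinearMap.trace ℝ V (ad ℝ V X * l) = 0 := by
  rw [H.trace_mul_map hexp]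
  refine Finset.sum_eq_zero fun k _ ↦ ?_
  rw [LieAlgebra.ad_apply, H.isSymm.eq, H.cyclic, H.lie_adjoint (hZ k)]
  simp

theorem trace_ad_mul_adjoint (H : IsTwist B h l j) (hexp : ∀ u ∈ h, u = ∑ k, B (Z k) u • Z k)
    (hZ : ∀ k, Z k ∈ h) (X : V) : LinearMap.trace ℝ V (ad ℝ V X * j) = 0 := by
  rw [H.trace_mul_adjoint hexp]
  refine Finset.sum_eq_zero fun k _ ↦ ?_
  rw [LieAlgebra.ad_apply, H.isSymm.eq, H.cyclic, H.adjoint_lie (hZ k)]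
  simp

theorem trace_twistConnection_flip (H : IsTwist B h l j)
    (hexp : ∀ u ∈ h, u = ∑ k, B (Z k) u • Z k) (hZ : ∀ k, Z k ∈ h) (W : V) :
    LinearMap.trace ℝ V ((twistConnection l j).flip W) = 0 := by
  rw [twistConnection_flip]
  simp only [map_add, map_sub, map_smul, H.trace_ad, LinearMap.trace_mul_comm ℝ l,
    H.trace_ad_mul_map hexp hZ, H.trace_ad_mul_adjoint hexp hZ]
  simp

/-- The cross terms in the Ricci tensor. -/
theorem trace_cross (H : IsTwist B h l j) (hexp : ∀ u ∈ h, u = ∑ k, B (Z k) u • Z k)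
    (hZ : ∀ k, Z k ∈ h) (W Y : V) :
    LinearMap.trace ℝ V (ad ℝ V (W + j W) * (ad ℝ V Y * j)) = B (mixedSum j Z W) Y ∧
    LinearMap.trace ℝ V (ad ℝ V (W + j W) * (l * ad ℝ V Y)) = B (mixedSum j Z W) Y ∧
    LinearMap.trace ℝ V (ad ℝ V (W + j W) * (ad ℝ V Y * l)) = B (mixedSum j Z W) Y := by
  have hN : ∀ W, B (mixedSum j Z W) Y =
      ∑ k, B (ad ℝ V (j (Z k)) (ad ℝ V (Z k) (W + j W))) Y := by
    intro W
    simp only [mixedSum, LinearMap.sum_apply, map_sum]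
    refine Finset.sum_congr rfl fun k _ ↦ ?_
    rw [H.ad_comm (hZ k), Module.End.mul_apply, map_add (ad ℝ V (Z k)),
      LieAlgebra.ad_apply ℝ V (Z k) (j W), H.lie_adjoint (hZ k), add_zero]
  refine ⟨?_, ?_, ?_⟩
  · rw [← mul_assoc, H.trace_mul_adjoint hexp, hN]
    exact Finset.sum_congr rfl fun k _ ↦ H.apply_ad_ad _ _ _ _
  · rw [← mul_assoc, LinearMap.trace_mul_comm, ← mul_assoc, H.trace_mul_map hexp, hN]
    refine Finset.sum_congr rfl fun k _ ↦ ?_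
    rw [Module.End.mul_apply, H.apply_ad_ad, H.apply_ad_ad', H.isSymm.eq]
  · rw [← mul_assoc, H.trace_mul_map hexp, hN]
    refine Finset.sum_congr rfl fun k _ ↦ ?_
    rw [Module.End.mul_apply, H.apply_ad_ad, ← Module.End.mul_apply, H.ad_comm (hZ k),
      Module.End.mul_apply]

/-- Put a = ad(W+jW), b = ad(Y+jY). The product ab gives the Killing term. Products with exactly one
of a, b contribute -½(½ - ½ + 1) times the mixed form, once for each factor. Of the nine others only
the two in which j and l become cyclically adjacent as jl survive, each with coefficient -¼. -/
theorem trace_twistConnection_flip_mul (H : IsTwist B h l j)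
    (hexp : ∀ u ∈ h, u = ∑ k, B (Z k) u • Z k) (hZ : ∀ k, Z k ∈ h) (W Y : V) :
    LinearMap.trace ℝ V ((twistConnection l j).flip W * (twistConnection l j).flip Y) =
      1 / 4 * LinearMap.trace ℝ V (ad ℝ V (W + j W) * ad ℝ V (Y + j Y))
        - B (mixedSum j Z W) Y - 1 / 2 * B (squareSum j Z W) Y := by
  obtain ⟨c₁, c₂, c₃⟩ := H.trace_cross hexp hZ W Y
  obtain ⟨d₁, d₂, d₃⟩ := H.trace_cross hexp hZ Y W
  rw [H.isSymm_mixedSum hZ, H.isSymm.eq] at d₁ d₂ d₃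
  rw [LinearMap.trace_mul_comm] at d₁ d₂ d₃
  have s₁ : LinearMap.trace ℝ V (ad ℝ V W * j * (l * ad ℝ V Y)) = B (squareSum j Z W) Y := by
    rw [← mul_assoc, LinearMap.trace_mul_comm, ← mul_assoc, ← mul_assoc, H.trace_mul_map hexp,
      H.isSymm_squareSum, H.isSymm.eq, squareSum, LinearMap.sum_apply, map_sum,
      LinearMap.sum_apply]
    exact Finset.sum_congr rfl fun k _ ↦ H.apply_ad_ad _ _ _ _
  have s₂ : LinearMap.trace ℝ V (l * ad ℝ V W * (ad ℝ V Y * j)) = B (squareSum j Z W) Y := by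
    rw [mul_assoc, LinearMap.trace_mul_comm, ← mul_assoc, H.trace_mul_map hexp,
      squareSum, LinearMap.sum_apply, map_sum, LinearMap.sum_apply]
    exact Finset.sum_congr rfl fun k _ ↦ H.apply_ad_ad _ _ _ _
  have z₁ : LinearMap.trace ℝ V (ad ℝ V W * j * (ad ℝ V Y * j)) = 0 := by
    rw [mul_assoc, ← mul_assoc j, H.adjoint_mul_ad_mul_adjoint, mul_zero, map_zero]
  have z₂ : LinearMap.trace ℝ V (ad ℝ V W * j * (ad ℝ V Y * l)) = 0 := by
    rw [mul_assoc, ← mul_assoc j, H.adjoint_mul_ad_mul_map, mul_zero, map_zero]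
  have z₃ : LinearMap.trace ℝ V (l * ad ℝ V W * (l * ad ℝ V Y)) = 0 := by
    rw [← mul_assoc, H.map_mul_ad_mul_map, zero_mul, map_zero]
  have z₄ : LinearMap.trace ℝ V (l * ad ℝ V W * (ad ℝ V Y * l)) = 0 := by
    rw [LinearMap.trace_mul_comm, mul_assoc, ← mul_assoc l, H.map_mul_map, zero_mul, mul_zero,
      map_zero]
  have z₅ : LinearMap.trace ℝ V (ad ℝ V W * l * (ad ℝ V Y * j)) = 0 := by
    rw [LinearMap.trace_mul_comm, mul_assoc, ← mul_assoc j, H.adjoint_mul_ad_mul_map, mul_zero,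
      map_zero]
  have z₆ : LinearMap.trace ℝ V (ad ℝ V W * l * (l * ad ℝ V Y)) = 0 := by
    rw [mul_assoc, ← mul_assoc l, H.map_mul_map, zero_mul, mul_zero, map_zero]
  have z₇ : LinearMap.trace ℝ V (ad ℝ V W * l * (ad ℝ V Y * l)) = 0 := by
    rw [mul_assoc, ← mul_assoc l, H.map_mul_ad_mul_map, mul_zero, map_zero]
  rw [twistConnection_flip, twistConnection_flip]
  generalize ad ℝ V (W + j W) = a at *
  generalize ad ℝ V (Y + j Y) = b at *
  simp only [add_mul, mul_add, sub_mul, mul_sub, smul_mul_assoc, mul_smul_comm, map_add, map_sub,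
    map_smul, smul_eq_mul, c₁, c₂, c₃, d₁, d₂, d₃, s₁, s₂, z₁, z₂, z₃, z₄, z₅, z₆, z₇]
  ring

/-- The Ricci operator of the scalar product `B` on `V` for the Lie bracket obtained from
`⁅·, ·⁆` by conjugation with `1 + l`, if `K` is the operator of the Killing form. -/
noncomputable def ricciOperator (K l j : End ℝ V) (Z : ι → V) : End ℝ V :=
  (1 / 2 : ℝ) • squareSum j Z + mixedSum j Z - (1 / 4 : ℝ) • ((1 + l) * K * (1 + j))

theorem neg_trace_twistConnection_flip_mul (H : IsTwist B h l j)
    (hexp : ∀ u ∈ h, u = ∑ k, B (Z k) u • Z k) (hZ : ∀ k, Z k ∈ h) {K : End ℝ V}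
    (hK : ∀ u v, B (K u) v = LinearMap.trace ℝ V (ad ℝ V u * ad ℝ V v)) (W Y : V) :
    - LinearMap.trace ℝ V ((twistConnection l j).flip W * (twistConnection l j).flip Y) =
      B (ricciOperator K l j Z W) Y := by
  rw [H.trace_twistConnection_flip_mul hexp hZ, ← hK]
  rw [← H.apply_conj]
  simp only [ricciOperator, LinearMap.add_apply, LinearMap.sub_apply, LinearMap.smul_apply,
    map_add, map_sub, map_smul, smul_eq_mul]
  ring

theorem isSymm_ricciOperator (H : IsTwist B h l j) (hZ : ∀ k, Z k ∈ h) {K : End ℝ V}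
    (hK : ∀ u v, B (K u) v = B u (K v)) (u v : V) :
    B (ricciOperator K l j Z u) v = B u (ricciOperator K l j Z v) := by
  have h₁ : B (((1 + l) * K * (1 + j)) u) v = B u (((1 + l) * K * (1 + j)) v) := by
    rw [H.apply_conj, H.isSymm.eq u, H.apply_conj, hK, H.isSymm.eq]
  simp only [ricciOperator, LinearMap.add_apply, LinearMap.sub_apply, LinearMap.smul_apply,
    map_add, map_sub, map_smul, smul_eq_mul, H.isSymm_squareSum, H.isSymm_mixedSum hZ, h₁]

theorem tensorNormSq_pullbackForm (H : IsTwist B h l j) (hZ : ∀ k, Z k ∈ h) {K : End ℝ V}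
    (hK : ∀ u v, B (K u) v = B u (K v)) {b : V → V → ℝ}
    (hb : ∀ u v, b u v = B (ricciOperator K l j Z ((1 + l) v)) ((1 + l) u)) :
    tensorNormSq (pullbackForm B l) b =
      LinearMap.trace ℝ V (ricciOperator K l j Z * ricciOperator K l j Z) := by
  set R := ricciOperator K l j Z
  have hR : ∀ u v, B (R u) v = B u (R v) := H.isSymm_ricciOperator hZ hK
  have h₁ : ∀ u v, pullbackForm B l u v = B ((1 + l) u) ((1 + l) v) := fun _ _ ↦ rfl
  have h₂ : ∀ u, (1 + l) ((1 - l) u) = u := fun u ↦ by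
    rw [← Module.End.mul_apply, H.one_add_mul_one_sub, Module.End.one_apply]
  rw [tensorNormSq_eq_trace H.nondegenerate_pullbackForm H.isSymm_pullbackForm
    ((1 - l) * R * (1 + l))]
  · have h₃ : (1 - l) * R * (1 + l) * ((1 - l) * R * (1 + l)) =
        (1 - l) * (R * R * (1 + l)) := by
      calc _ = (1 - l) * R * ((1 + l) * (1 - l)) * R * (1 + l) := by noncomm_ring
        _ = _ := by rw [H.one_add_mul_one_sub]; noncomm_ring
    rw [h₃, LinearMap.trace_mul_comm, mul_assoc, H.one_add_mul_one_sub, mul_one]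
  · intro u v
    simp only [h₁, Module.End.mul_apply, h₂]
    rw [hb, hR, H.isSymm.eq]
  · intro u v
    simp only [h₁, Module.End.mul_apply, h₂]
    exact hR _ _

end IsTwist
end TwistRicci

/-! ### Comparison of the traces for two aligned twists. -/

section TwistComparison

open Module (End)
open LieAlgebra (ad)

variable {V : Type*} [LieRing V] [LieAlgebra ℝ V]

/-- Polarization of the quadratic form `x ↦ tr (w x ^ 2)`, for `w` commuting with the arguments. -/
theorem trace_polarization_quadratic {M : Type*} [AddCommGroup M] [Module ℝ M]
    {w x y : End ℝ M} (hx : w * x = x * w) :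
    4 * LinearMap.trace ℝ M (w * (x * y)) =
      LinearMap.trace ℝ M (w * ((x + y) * (x + y)))
        - LinearMap.trace ℝ M (w * ((x - y) * (x - y))) := by
  have h₁ : LinearMap.trace ℝ M (w * (y * x)) = LinearMap.trace ℝ M (w * (x * y)) := by
    rw [← mul_assoc, LinearMap.trace_mul_comm, ← mul_assoc, ← hx, mul_assoc]
  rw [← map_sub]
  have h₂ : w * ((x + y) * (x + y)) - w * ((x - y) * (x - y)) =
      (2 : ℝ) • (w * (x * y)) + (2 : ℝ) • (w * (y * x)) := by
    simp only [two_smul]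
    noncomm_ring
  rw [h₂, map_add, map_smul, map_smul, h₁]
  simp only [smul_eq_mul]
  ring

/-- Polarization of the cubic form `x ↦ tr (w x ^ 3)`, for `w` commuting with the arguments. -/
theorem trace_polarization_cubic {M : Type*} [AddCommGroup M] [Module ℝ M]
    {w x y : End ℝ M} (hx : w * x = x * w) :
    6 * LinearMap.trace ℝ M (w * (x * x * y)) =
      LinearMap.trace ℝ M (w * ((y + x) * (y + x) * (y + x)))
        + LinearMap.trace ℝ M (w * ((y - x) * (y - x) * (y - x)))
        - 2 * LinearMap.trace ℝ M (w * (y * y * y)) := by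
  have h₁ : LinearMap.trace ℝ M (w * (x * y * x)) = LinearMap.trace ℝ M (w * (x * x * y)) := by
    rw [← mul_assoc, LinearMap.trace_mul_comm, ← mul_assoc, ← hx]
    simp only [mul_assoc]
  have h₂ : LinearMap.trace ℝ M (w * (y * x * x)) = LinearMap.trace ℝ M (w * (x * x * y)) := by
    rw [← h₁, ← mul_assoc, LinearMap.trace_mul_comm, ← mul_assoc, ← hx]
    simp only [mul_assoc]
  have h₃ : w * ((y + x) * (y + x) * (y + x)) + w * ((y - x) * (y - x) * (y - x)) =
      (2 : ℝ) • (w * (y * y * y)) + (2 : ℝ) • (w * (x * x * y)) + (2 : ℝ) • (w * (x * y * x))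
        + (2 : ℝ) • (w * (y * x * x)) := by
    simp only [two_smul]
    noncomm_ring
  have h₄ := congrArg (LinearMap.trace ℝ M) h₃
  simp only [map_add, map_smul, smul_eq_mul, h₁, h₂] at h₄
  rw [h₄]
  ring

namespace IsTwist

variable {B : LinearMap.BilinForm ℝ V} {h : Submodule ℝ V} {l j l' j' : End ℝ V}
  {ι : Type*} [Fintype ι] {Z : ι → V}

theorem squareSum_mul_map (H : IsTwist B h l j) : squareSum j Z * l = 0 := by
  ext u
  simp [squareSum, H.adjoint_lie (H.map_mem u)]

theorem mixedSum_mul_map (H : IsTwist B h l j) : mixedSum j Z * l = 0 := by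
  ext u
  simp [mixedSum, H.adjoint_lie (H.map_mem u)]

theorem adjoint_mul_squareSum (H : IsTwist B h l j) : j * squareSum j Z = 0 := by
  ext u
  refine H.eq_of_forall fun w ↦ ?_
  rw [Module.End.mul_apply, H.adjoint, H.isSymm_squareSum, ← Module.End.mul_apply,
    H.squareSum_mul_map]
  simp

theorem adjoint_mul_mixedSum (H : IsTwist B h l j) (hZ : ∀ k, Z k ∈ h) : j * mixedSum j Z = 0 := by
  ext u
  refine H.eq_of_forall fun w ↦ ?_
  rw [Module.End.mul_apply, H.adjoint, H.isSymm_mixedSum hZ, ← Module.End.mul_apply,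
    H.mixedSum_mul_map]
  simp

/-- P absorbs 1 + l on its right, and after a cyclic shift also 1 + j on its left. This removes l
and j from the cross terms with the Killing part. -/
theorem trace_mul_conj {P : End ℝ V} (hl : P * l = 0) (hj : j * P = 0) (K : End ℝ V) :
    LinearMap.trace ℝ V (P * ((1 + l) * K * (1 + j))) = LinearMap.trace ℝ V (P * K) := by
  have h₁ : P * ((1 + l) * K * (1 + j)) = P * K * (1 + j) := by
    calc _ = (P + P * l) * K * (1 + j) := by noncomm_ring
      _ = _ := by rw [hl, add_zero]
  rw [h₁, LinearMap.trace_mul_comm, add_mul, ← mul_assoc j, hj, zero_mul, add_zero, one_mul]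

theorem trace_ricciOperator_sq (H : IsTwist B h l j) (hZ : ∀ k, Z k ∈ h) (K : End ℝ V) :
    LinearMap.trace ℝ V (ricciOperator K l j Z * ricciOperator K l j Z) =
      1 / 4 * LinearMap.trace ℝ V (squareSum j Z * squareSum j Z)
        + (LinearMap.trace ℝ V (mixedSum j Z * mixedSum j Z)
          + LinearMap.trace ℝ V (squareSum j Z * mixedSum j Z)
          - 1 / 4 * LinearMap.trace ℝ V (squareSum j Z * K)
          - 1 / 2 * LinearMap.trace ℝ V (mixedSum j Z * K)
          + 1 / 16 * LinearMap.trace ℝ V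
            ((1 + l) * K * (1 + j) * ((1 + l) * K * (1 + j)))) := by
  have h₁ := trace_mul_conj (H.squareSum_mul_map (Z := Z)) H.adjoint_mul_squareSum K
  have h₂ := trace_mul_conj (H.mixedSum_mul_map (Z := Z)) (H.adjoint_mul_mixedSum hZ) K
  have h₃ := LinearMap.trace_mul_comm ℝ (mixedSum j Z) (squareSum j Z)
  have h₄ := LinearMap.trace_mul_comm ℝ (squareSum j Z) ((1 + l) * K * (1 + j))
  have h₅ := LinearMap.trace_mul_comm ℝ (mixedSum j Z) ((1 + l) * K * (1 + j))
  rw [h₁] at h₄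
  rw [h₂] at h₅
  unfold ricciOperator
  generalize (1 + l) * K * (1 + j) = L at *
  simp only [add_mul, mul_add, sub_mul, mul_sub, smul_mul_assoc, mul_smul_comm, map_add, map_sub,
    map_smul, smul_eq_mul, h₁, h₂, h₃, ← h₄, ← h₅]
  ring

/-- The trace of the square of the Killing part of the Ricci operator. -/
theorem trace_conj_sq [FiniteDimensional ℝ V] (H : IsTwist B h l j)
    (hexp : ∀ u ∈ h, u = ∑ k, B (Z k) u • Z k)
    (K : End ℝ V) :
    LinearMap.trace ℝ V ((1 + l) * K * (1 + j) * ((1 + l) * K * (1 + j))) =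
      LinearMap.trace ℝ V (K * K)
        + 2 * (∑ k, B (Z k + j (Z k)) (K (K (Z k + j (Z k)))) - ∑ k, B (Z k) (K (K (Z k))))
        + ∑ k, ∑ m, (B (Z m + j (Z m)) (K (Z k + j (Z k))) * B (Z k + j (Z k)) (K (Z m + j (Z m)))
          - B (Z m) (K (Z k + j (Z k))) * B (Z k + j (Z k)) (K (Z m))
          - B (Z m + j (Z m)) (K (Z k)) * B (Z k) (K (Z m + j (Z m)))
          + B (Z m) (K (Z k)) * B (Z k) (K (Z m))) := by
  -- Here 1 + T = (1+j)(1+l), and completing the square in each basis vector writes T through Z_k +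
  -- j Z_k and Z_k alone.
  set T := j + l + j * l with hT
  have hT' : ∀ X, T X = ∑ k, B (Z k + j (Z k)) X • (Z k + j (Z k)) - ∑ k, B (Z k) X • Z k := by
    intro X
    rw [hT, LinearMap.add_apply, LinearMap.add_apply, Module.End.mul_apply, H.map_eq_sum hexp,
      H.adjoint_eq_sum hexp X, ← Finset.sum_sub_distrib, map_sum, ← Finset.sum_add_distrib,
      ← Finset.sum_add_distrib]
    refine Finset.sum_congr rfl fun k _ ↦ ?_
    simp only [map_add, map_smul, LinearMap.add_apply]
    module
  have htr : ∀ M : End ℝ V, LinearMap.trace ℝ V (M * T) =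
      ∑ k, B (Z k + j (Z k)) (M (Z k + j (Z k))) - ∑ k, B (Z k) (M (Z k)) := by
    intro M
    let T₁ : End ℝ V := ∑ k, (B (Z k + j (Z k))).smulRight (Z k + j (Z k))
    let T₂ : End ℝ V := ∑ k, (B (Z k)).smulRight (Z k)
    have h₁ : ∀ X, T₁ X = ∑ k, B (Z k + j (Z k)) X • (Z k + j (Z k)) := by intro X; simp [T₁]
    have h₂ : ∀ X, T₂ X = ∑ k, B (Z k) X • Z k := by intro X; simp [T₂]
    have h₃ : T = T₁ - T₂ := by
      ext X; rw [hT', LinearMap.sub_apply, h₁, h₂]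
    rw [h₃, mul_sub, map_sub, trace_smulRight_sum h₁, trace_smulRight_sum h₂]
  have h₁ : LinearMap.trace ℝ V ((1 + l) * K * (1 + j) * ((1 + l) * K * (1 + j))) =
      LinearMap.trace ℝ V (K * K) + 2 * LinearMap.trace ℝ V (K * K * T)
        + LinearMap.trace ℝ V (K * T * K * T) := by
    have h₂ : (1 + l) * K * (1 + j) * ((1 + l) * K * (1 + j)) =
        (1 + l) * (K * (1 + T) * K * (1 + j)) := by rw [hT]; noncomm_ring
    have h₃ : K * (1 + T) * K * (1 + j) * (1 + l) =
        K * K + K * K * T + K * T * K + K * T * K * T := by rw [hT]; noncomm_ring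
    have h₄ : LinearMap.trace ℝ V (K * T * K) = LinearMap.trace ℝ V (K * K * T) := by
      rw [mul_assoc, LinearMap.trace_mul_comm, mul_assoc, LinearMap.trace_mul_comm]
    rw [h₂, LinearMap.trace_mul_comm, h₃, map_add, map_add, map_add, h₄]
    ring
  have h₂ : ∀ u v : V, B u (K (T (K v))) =
      ∑ m, B (Z m + j (Z m)) (K v) * B u (K (Z m + j (Z m))) - ∑ m, B (Z m) (K v) * B u (K (Z m)) := by
    intro u v
    rw [hT', map_sub, map_sub, map_sum, map_sum, map_sum, map_sum]
    simp only [map_smul, smul_eq_mul]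
  rw [h₁, htr, htr]
  simp only [Module.End.mul_apply]
  simp only [h₂]
  simp only [Finset.sum_sub_distrib, Finset.sum_add_distrib]
  ring

section Aligned

/-- For every `z ∈ h` there is an isometric automorphism that fixes `h` pointwise and maps `j' z`
to `j z`. -/
def IsAligned (B : LinearMap.BilinForm ℝ V) (h : Submodule ℝ V) (j j' : End ℝ V) : Prop :=
  ∀ z ∈ h, ∃ α : V ≃ₗ⁅ℝ⁆ V, (∀ u v, B (α u) (α v) = B u v) ∧ (∀ w ∈ h, α w = w) ∧ α (j' z) = j z

theorem trace_ad_mul_ad_map (α : V ≃ₗ⁅ℝ⁆ V) (u v : V) :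
    LinearMap.trace ℝ V (ad ℝ V (α u) * ad ℝ V (α v)) =
      LinearMap.trace ℝ V (ad ℝ V u * ad ℝ V v) := by
  rw [← LieAlgebra.conj_ad_apply, ← LieAlgebra.conj_ad_apply, Module.End.mul_eq_comp,
    ← LinearEquiv.conj_comp, LinearMap.trace_conj']
  rfl

variable {K : End ℝ V}

/-- Automorphisms preserve the Killing form; those that also preserve B commute with the operator
relating the two. -/
theorem killing_map (H : IsTwist B h l j)
    (hK : ∀ u v, B (K u) v = LinearMap.trace ℝ V (ad ℝ V u * ad ℝ V v)) {α : V ≃ₗ⁅ℝ⁆ V}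
    (hα : ∀ u v, B (α u) (α v) = B u v) (u : V) : K (α u) = α (K u) := by
  refine H.eq_of_forall fun w ↦ ?_
  obtain ⟨w, rfl⟩ : ∃ v, α v = w := α.surjective w
  rw [hK, hα, trace_ad_mul_ad_map, hK]

theorem conj_killing (H : IsTwist B h l j)
    (hK : ∀ u v, B (K u) v = LinearMap.trace ℝ V (ad ℝ V u * ad ℝ V v)) {α : V ≃ₗ⁅ℝ⁆ V}
    (hα : ∀ u v, B (α u) (α v) = B u v) : (α : V ≃ₗ[ℝ] V).conj K = K := by
  ext u
  obtain ⟨u, rfl⟩ : ∃ v, α v = u := α.surjective u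
  rw [H.killing_map hK hα, LinearEquiv.conj_apply_apply]
  exact congrArg (fun v ↦ α (K v)) (α.symm_apply_apply u)

/-- The automorphism depends on z, so conjugating the trace works only because j enters at this one
point. -/
theorem trace_quadratic_eq (hj : IsAligned B h j j') {u v z : V} (hu : u ∈ h) (hv : v ∈ h)
    (hz : z ∈ h) :
    LinearMap.trace ℝ V (ad ℝ V u * ad ℝ V v * (ad ℝ V (j z) * ad ℝ V (j z))) =
      LinearMap.trace ℝ V (ad ℝ V u * ad ℝ V v * (ad ℝ V (j' z) * ad ℝ V (j' z))) := by
  obtain ⟨α, -, hα, hz⟩ := hj z hz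
  rw [← LinearMap.trace_conj' (ad ℝ V u * ad ℝ V v * (ad ℝ V (j' z) * ad ℝ V (j' z)))
    (α : V ≃ₗ[ℝ] V)]
  simp only [Module.End.mul_eq_comp, LinearEquiv.conj_comp, LieAlgebra.conj_ad_apply, hz, hα u hu,
    hα v hv]

theorem trace_cubic_eq (hj : IsAligned B h j j') {u z : V} (hu : u ∈ h) (hz : z ∈ h) :
    LinearMap.trace ℝ V (ad ℝ V u * (ad ℝ V (j z) * ad ℝ V (j z) * ad ℝ V (j z))) =
      LinearMap.trace ℝ V (ad ℝ V u * (ad ℝ V (j' z) * ad ℝ V (j' z) * ad ℝ V (j' z))) := by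
  obtain ⟨α, -, hα, hz⟩ := hj z hz
  rw [← LinearMap.trace_conj' (ad ℝ V u * (ad ℝ V (j' z) * ad ℝ V (j' z) * ad ℝ V (j' z)))
    (α : V ≃ₗ[ℝ] V)]
  simp only [Module.End.mul_eq_comp, LinearEquiv.conj_comp, LieAlgebra.conj_ad_apply, hz, hα u hu]

theorem trace_mixedSum_sq_eq (H : IsTwist B h l j) (H' : IsTwist B h l' j')
    (hj : IsAligned B h j j') (hZ : ∀ k, Z k ∈ h) :
    LinearMap.trace ℝ V (mixedSum j Z * mixedSum j Z) =
      LinearMap.trace ℝ V (mixedSum j' Z * mixedSum j' Z) := by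
  simp only [mixedSum, Finset.sum_mul_sum, map_sum]
  refine Finset.sum_congr rfl fun k _ ↦ Finset.sum_congr rfl fun m _ ↦ ?_
  have key : ∀ {l₁ j₁ : End ℝ V}, IsTwist B h l₁ j₁ →
      4 * LinearMap.trace ℝ V
        (ad ℝ V (Z k) * ad ℝ V (j₁ (Z k)) * (ad ℝ V (Z m) * ad ℝ V (j₁ (Z m)))) =
      LinearMap.trace ℝ V (ad ℝ V (Z k) * ad ℝ V (Z m)
          * (ad ℝ V (j₁ (Z k + Z m)) * ad ℝ V (j₁ (Z k + Z m))))
        - LinearMap.trace ℝ V (ad ℝ V (Z k) * ad ℝ V (Z m)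
          * (ad ℝ V (j₁ (Z k - Z m)) * ad ℝ V (j₁ (Z k - Z m)))) := by
    intro l₁ j₁ H₁
    -- With w = ad(Z_k) ad(Z_m) fixed, only its commutation with ad(j₁ Z_k) is needed to polarize in
    -- z = Z_k ± Z_m.
    have h₁ : ad ℝ V (Z k) * ad ℝ V (Z m) * ad ℝ V (j₁ (Z k)) =
        ad ℝ V (j₁ (Z k)) * (ad ℝ V (Z k) * ad ℝ V (Z m)) := by
      rw [mul_assoc, H₁.ad_comm (hZ m), ← mul_assoc, H₁.ad_comm (hZ k), mul_assoc]
    simp only [map_add, map_sub]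
    rw [← trace_polarization_quadratic h₁, mul_assoc (ad ℝ V (Z k)), ← mul_assoc (ad ℝ V (j₁ (Z k))),
      ← H₁.ad_comm (hZ m)]
    simp only [mul_assoc]
  have h₁ := key H
  have h₂ := key H'
  rw [trace_quadratic_eq hj (hZ k) (hZ m) (add_mem (hZ k) (hZ m)),
    trace_quadratic_eq hj (hZ k) (hZ m) (sub_mem (hZ k) (hZ m))] at h₁
  linarith

/-- Each summand polarizes the cubic form z ↦ tr(ad(Z_m) ad(jz)³), evaluated at Z_m ± Z_k and Z_m.
-/
theorem trace_squareSum_mul_mixedSum_eq (H : IsTwist B h l j) (H' : IsTwist B h l' j')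
    (hj : IsAligned B h j j') (hZ : ∀ k, Z k ∈ h) :
    LinearMap.trace ℝ V (squareSum j Z * mixedSum j Z) =
      LinearMap.trace ℝ V (squareSum j' Z * mixedSum j' Z) := by
  simp only [mixedSum, squareSum, Finset.sum_mul_sum, map_sum]
  refine Finset.sum_congr rfl fun k _ ↦ Finset.sum_congr rfl fun m _ ↦ ?_
  have key : ∀ {l₁ j₁ : End ℝ V}, IsTwist B h l₁ j₁ →
      6 * LinearMap.trace ℝ V
        (ad ℝ V (j₁ (Z k)) * ad ℝ V (j₁ (Z k)) * (ad ℝ V (Z m) * ad ℝ V (j₁ (Z m)))) =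
      LinearMap.trace ℝ V (ad ℝ V (Z m) * (ad ℝ V (j₁ (Z m + Z k)) * ad ℝ V (j₁ (Z m + Z k))
          * ad ℝ V (j₁ (Z m + Z k))))
        + LinearMap.trace ℝ V (ad ℝ V (Z m) * (ad ℝ V (j₁ (Z m - Z k)) * ad ℝ V (j₁ (Z m - Z k))
          * ad ℝ V (j₁ (Z m - Z k))))
        - 2 * LinearMap.trace ℝ V (ad ℝ V (Z m) * (ad ℝ V (j₁ (Z m)) * ad ℝ V (j₁ (Z m))
          * ad ℝ V (j₁ (Z m)))) := by
    intro l₁ j₁ H₁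
    simp only [map_add, map_sub]
    rw [← trace_polarization_cubic (H₁.ad_comm (hZ m) (Z k)), ← mul_assoc (_ * _),
      mul_assoc (ad ℝ V (j₁ (Z k))), ← H₁.ad_comm (hZ m), ← mul_assoc (ad ℝ V (j₁ (Z k))),
      ← H₁.ad_comm (hZ m)]
    simp only [mul_assoc]
  have h₁ := key H
  have h₂ := key H'
  rw [trace_cubic_eq hj (hZ m) (add_mem (hZ m) (hZ k)),
    trace_cubic_eq hj (hZ m) (sub_mem (hZ m) (hZ k)), trace_cubic_eq hj (hZ m) (hZ m)] at h₁
  linarith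

theorem trace_squareSum_mul_killing_eq (H : IsTwist B h l j) (hj : IsAligned B h j j')
    (hZ : ∀ k, Z k ∈ h) (hK : ∀ u v, B (K u) v = LinearMap.trace ℝ V (ad ℝ V u * ad ℝ V v)) :
    LinearMap.trace ℝ V (squareSum j Z * K) = LinearMap.trace ℝ V (squareSum j' Z * K) := by
  simp only [squareSum, Finset.sum_mul, map_sum]
  refine Finset.sum_congr rfl fun k _ ↦ ?_
  obtain ⟨α, hα, -, hz⟩ := hj _ (hZ k)
  rw [← LinearMap.trace_conj' (ad ℝ V (j' (Z k)) * ad ℝ V (j' (Z k)) * K) (α : V ≃ₗ[ℝ] V)]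
  simp only [Module.End.mul_eq_comp, LinearEquiv.conj_comp, LieAlgebra.conj_ad_apply, hz,
    H.conj_killing hK hα]

theorem trace_mixedSum_mul_killing_eq (H : IsTwist B h l j) (hj : IsAligned B h j j')
    (hZ : ∀ k, Z k ∈ h) (hK : ∀ u v, B (K u) v = LinearMap.trace ℝ V (ad ℝ V u * ad ℝ V v)) :
    LinearMap.trace ℝ V (mixedSum j Z * K) = LinearMap.trace ℝ V (mixedSum j' Z * K) := by
  simp only [mixedSum, Finset.sum_mul, map_sum]
  refine Finset.sum_congr rfl fun k _ ↦ ?_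
  obtain ⟨α, hα, hα', hz⟩ := hj _ (hZ k)
  rw [← LinearMap.trace_conj' (ad ℝ V (Z k) * ad ℝ V (j' (Z k)) * K) (α : V ≃ₗ[ℝ] V)]
  simp only [Module.End.mul_eq_comp, LinearEquiv.conj_comp, LieAlgebra.conj_ad_apply, hz,
    H.conj_killing hK hα, hα' _ (hZ k)]

theorem isSymm_killing (H : IsTwist B h l j)
    (hK : ∀ u v, B (K u) v = LinearMap.trace ℝ V (ad ℝ V u * ad ℝ V v)) (u v : V) :
    B (K u) v = B u (K v) := by
  rw [hK, LinearMap.trace_mul_comm, ← hK, H.isSymm.eq]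

theorem apply_killing_eq_left (H : IsTwist B h l j) (hj : IsAligned B h j j')
    (hK : ∀ u v, B (K u) v = LinearMap.trace ℝ V (ad ℝ V u * ad ℝ V v)) {u z : V}
    (hu : u ∈ h) (hz : z ∈ h) : B u (K (z + j z)) = B u (K (z + j' z)) := by
  obtain ⟨α, hα, hα', hjz⟩ := hj _ hz
  rw [← hα u (K (z + j' z)), ← H.killing_map hK hα, map_add α, hjz, hα' _ hz, hα' _ hu]

theorem apply_killing_eq_right (H : IsTwist B h l j) (hj : IsAligned B h j j')
    (hK : ∀ u v, B (K u) v = LinearMap.trace ℝ V (ad ℝ V u * ad ℝ V v)) {u z : V}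
    (hu : u ∈ h) (hz : z ∈ h) : B (z + j z) (K u) = B (z + j' z) (K u) := by
  rw [← H.isSymm_killing hK, ← H.isSymm_killing hK, ← H.isSymm.eq, ← H.isSymm.eq u,
    H.apply_killing_eq_left hj hK hu hz]

theorem apply_killing_killing_eq (H : IsTwist B h l j) (hj : IsAligned B h j j')
    (hK : ∀ u v, B (K u) v = LinearMap.trace ℝ V (ad ℝ V u * ad ℝ V v)) {z : V} (hz : z ∈ h) :
    B (z + j z) (K (K (z + j z))) = B (z + j' z) (K (K (z + j' z))) := by
  obtain ⟨α, hα, hα', hjz⟩ := hj _ hz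
  rw [← hα (z + j' z), ← H.killing_map hK hα, ← H.killing_map hK hα, map_add α, hjz, hα' _ hz]

theorem apply_killing_eq (H : IsTwist B h l j) (hj : IsAligned B h j j')
    (hK : ∀ u v, B (K u) v = LinearMap.trace ℝ V (ad ℝ V u * ad ℝ V v)) {u z : V}
    (hu : u ∈ h) (hz : z ∈ h) : B (u + j u) (K (z + j z)) = B (u + j' u) (K (z + j' z)) := by
  have hd : ∀ {z : V}, z ∈ h → B (z + j z) (K (z + j z)) = B (z + j' z) (K (z + j' z)) := by
    intro z hz
    obtain ⟨α, hα, hα', hjz⟩ := hj _ hz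
    rw [← hα (z + j' z), ← H.killing_map hK hα, map_add α, hjz, hα' _ hz]
  -- The automorphisms for u and z may differ, so equality is first obtained on the diagonal and
  -- then polarized, using symmetry of K.
  have hp : ∀ j₁ : End ℝ V, 4 * B (u + j₁ u) (K (z + j₁ z)) =
      B (u + z + j₁ (u + z)) (K (u + z + j₁ (u + z)))
        - B (u - z + j₁ (u - z)) (K (u - z + j₁ (u - z))) := by
    intro j₁
    have h₁ : u + z + j₁ (u + z) = (u + j₁ u) + (z + j₁ z) := by rw [map_add]; abel
    have h₂ : u - z + j₁ (u - z) = (u + j₁ u) - (z + j₁ z) := by rw [map_sub]; abel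
    have h₃ : B (z + j₁ z) (K (u + j₁ u)) = B (u + j₁ u) (K (z + j₁ z)) := by
      rw [← H.isSymm_killing hK, H.isSymm.eq]
    rw [h₁, h₂]
    generalize u + j₁ u = x at *
    generalize z + j₁ z = y at *
    simp only [map_add, map_sub, LinearMap.add_apply, LinearMap.sub_apply, h₃]
    ring
  have h₁ := hp j
  rw [hd (add_mem hu hz), hd (sub_mem hu hz), ← hp j'] at h₁
  linarith

theorem trace_conj_sq_eq [FiniteDimensional ℝ V] (H : IsTwist B h l j)
    (H' : IsTwist B h l' j') (hj : IsAligned B h j j')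
    (hZ : ∀ k, Z k ∈ h) (hexp : ∀ u ∈ h, u = ∑ k, B (Z k) u • Z k)
    (hK : ∀ u v, B (K u) v = LinearMap.trace ℝ V (ad ℝ V u * ad ℝ V v)) :
    LinearMap.trace ℝ V ((1 + l) * K * (1 + j) * ((1 + l) * K * (1 + j))) =
      LinearMap.trace ℝ V ((1 + l') * K * (1 + j') * ((1 + l') * K * (1 + j'))) := by
  rw [H.trace_conj_sq hexp, H'.trace_conj_sq hexp]
  simp only [H.apply_killing_killing_eq hj hK (hZ _), H.apply_killing_eq hj hK (hZ _) (hZ _),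
    H.apply_killing_eq_left hj hK (hZ _) (hZ _), H.apply_killing_eq_right hj hK (hZ _) (hZ _)]

theorem trace_ricciOperator_sq_sub [FiniteDimensional ℝ V] (H : IsTwist B h l j)
    (H' : IsTwist B h l' j')
    (hj : IsAligned B h j j') (hZ : ∀ k, Z k ∈ h) (hexp : ∀ u ∈ h, u = ∑ k, B (Z k) u • Z k)
    (hK : ∀ u v, B (K u) v = LinearMap.trace ℝ V (ad ℝ V u * ad ℝ V v)) :
    LinearMap.trace ℝ V (ricciOperator K l j Z * ricciOperator K l j Z)
      - LinearMap.trace ℝ V (ricciOperator K l' j' Z * ricciOperator K l' j' Z) =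
    1 / 4 * (LinearMap.trace ℝ V (squareSum j Z * squareSum j Z)
      - LinearMap.trace ℝ V (squareSum j' Z * squareSum j' Z)) := by
  rw [H.trace_ricciOperator_sq hZ, H'.trace_ricciOperator_sq hZ, H.trace_mixedSum_sq_eq H' hj hZ,
    H.trace_squareSum_mul_mixedSum_eq H' hj hZ, H.trace_squareSum_mul_killing_eq hj hZ hK,
    H.trace_mixedSum_mul_killing_eq hj hZ hK, H.trace_conj_sq_eq H' hj hZ hexp hK]
  ring

end Aligned

end IsTwist
end TwistComparison

/-! ### The Killing operator and orthonormal expansions. -/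

section KillingOperator

open LieAlgebra (ad)

theorem exists_killing_operator {V : Type*} [LieRing V] [LieAlgebra ℝ V] [FiniteDimensional ℝ V]
    {B : LinearMap.BilinForm ℝ V} (hB : B.Nondegenerate) :
    ∃ K : Module.End ℝ V, ∀ u v, B (K u) v = LinearMap.trace ℝ V (ad ℝ V u * ad ℝ V v) :=
  ⟨(B.toDual hB).symm.toLinearMap ∘ₗ killingForm ℝ V, fun u v ↦ by
    simp [LinearMap.BilinForm.apply_toDual_symm_apply, killingForm_apply_apply]
    rfl⟩

theorem eq_sum_of_orthonormal {V : Type*} [AddCommGroup V] [Module ℝ V] {h : Submodule ℝ V}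
    {ι : Type*} [Fintype ι] [DecidableEq ι] {B : LinearMap.BilinForm ℝ V}
    (Z : Module.Basis ι ℝ h) (hZ : ∀ p q, B (Z p) (Z q) = if p = q then 1 else 0) {u : V}
    (hu : u ∈ h) : u = ∑ k, B (Z k) u • (Z k : V) := by
  have h₁ : u = ∑ k, Z.repr ⟨u, hu⟩ k • (Z k : V) := by
    have h₂ := congrArg h.subtype (Z.sum_repr ⟨u, hu⟩)
    simp only [map_sum, map_smul, Submodule.subtype_apply] at h₂
    exact h₂.symm
  have h₂ : ∀ k, B (Z k) u = Z.repr ⟨u, hu⟩ k := by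
    intro k
    conv_lhs => rw [h₁]
    simp [hZ]
  simp only [h₂]
  exact h₁

end KillingOperator

/-! ### Return to the Lie group. -/

section Group

variable {E : Type*} [NormedAddCommGroup E] [NormedSpace ℝ E] [FiniteDimensional ℝ E]
  {G : Type*} [TopologicalSpace G] [ChartedSpace E G] [Group G] [LieGroup 𝓘(ℝ, E) ∞ G]
  {g₀ : ContMDiffRiemannianMetric 𝓘(ℝ, E) ∞ E (fun x : G ↦ TangentSpace 𝓘(ℝ, E) x)}
  {𝔥 : Submodule ℝ (GroupLieAlgebra 𝓘(ℝ, E) G)}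
  {l l' : GroupLieAlgebra 𝓘(ℝ, E) G →ₗ[ℝ] GroupLieAlgebra 𝓘(ℝ, E) G}

theorem transpose_apply (l : GroupLieAlgebra 𝓘(ℝ, E) G →ₗ[ℝ] GroupLieAlgebra 𝓘(ℝ, E) G)
    (u v : GroupLieAlgebra 𝓘(ℝ, E) G) :
    scalarProduct g₀ (transpose g₀ l u) v = scalarProduct g₀ u (l v) :=
  LinearMap.BilinForm.isAdjointPairLeftAdjointOfNondegenerate _ _ l u v

theorem IsAdmissible.isTwist (hl : IsAdmissible (scalarProduct g₀) 𝔥 l) (hg₀ : IsBiInvariant g₀)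
    (h𝔥 : ∀ u ∈ 𝔥, ∀ v ∈ 𝔥, ⁅u, v⁆ = 0) :
    IsTwist (scalarProduct g₀) 𝔥 l (transpose g₀ l) where
  nondegenerate := scalarProduct_nondegenerate g₀
  isSymm := scalarProduct_isSymm g₀
  invariant := scalarProduct_lie hg₀
  abelian := h𝔥
  map_mem := hl.map_mem
  map_eq_zero u hu := hl.map_eq_zero u (Submodule.mem_sup_left hu)
  map_lie u hu v := by
    -- For w in the centralizer, B(w,[u,v]) = -B([u,w],v) = 0, so [u,v] lies in 𝔲.
    refine hl.map_eq_zero _ (Submodule.mem_sup_right fun w hw ↦ ?_)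
    have hw : ⁅w, u⁆ = 0 := hw u hu
    have h := scalarProduct_lie hg₀ u w v
    rw [← lie_skew, hw, neg_zero, map_zero, LinearMap.zero_apply] at h
    exact neg_eq_zero.1 h.symm
  adjoint := transpose_apply l

/-- Transposing the hypothesis gives ⟨j'z, X⟩ = ⟨jz, Ad_a X⟩ for all X; since Ad_a is an isometry,
Ad_a(j'z) = jz. -/
theorem isAligned_of_Ad (hg₀ : IsBiInvariant g₀)
    (h3 : ∀ Z ∈ 𝔥, ∃ a : G,
      (∀ X : GroupLieAlgebra 𝓘(ℝ, E) G,
        scalarProduct g₀ (l' X) Z = scalarProduct g₀ (l (Ad a X)) Z) ∧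
      ∀ W ∈ 𝔥, Ad a W = W) :
    IsTwist.IsAligned (scalarProduct g₀) 𝔥 (transpose g₀ l) (transpose g₀ l') := by
  intro z hz
  obtain ⟨a, ha, hfix⟩ := h3 z hz
  have hinv : ∀ X : GroupLieAlgebra 𝓘(ℝ, E) G, Ad a (Ad a⁻¹ X) = X := fun X ↦ by
    simpa using Ad_inv_Ad a⁻¹ X
  let α : GroupLieAlgebra 𝓘(ℝ, E) G ≃ₗ⁅ℝ⁆ GroupLieAlgebra 𝓘(ℝ, E) G :=
    { Ad a with
      map_lie' := fun {v w} ↦ Ad_lie a v w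
      invFun := Ad a⁻¹
      left_inv := Ad_inv_Ad a
      right_inv := hinv }
  have hs := scalarProduct_isSymm g₀
  refine ⟨α, inner_Ad_Ad hg₀ a, hfix, ?_⟩
  refine sub_eq_zero.1 ((scalarProduct_nondegenerate g₀).1 _ fun Y ↦ ?_)
  rw [map_sub, LinearMap.sub_apply, sub_eq_zero, ← hinv Y]
  change scalarProduct g₀ (Ad a _) _ = _
  rw [inner_Ad_Ad hg₀, transpose_apply, transpose_apply, hs.eq, ha, hs.eq]

theorem tensorNormSq_ricci_leftInvariantMetric
    {j : GroupLieAlgebra 𝓘(ℝ, E) G →ₗ[ℝ] GroupLieAlgebra 𝓘(ℝ, E) G}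
    (H : IsTwist (scalarProduct g₀) 𝔥 l j)
    {ι : Type*} [Fintype ι] {Z : ι → GroupLieAlgebra 𝓘(ℝ, E) G} (hZ : ∀ k, Z k ∈ 𝔥)
    (hexp : ∀ u ∈ 𝔥, u = ∑ k, scalarProduct g₀ (Z k) u • Z k)
    {K : Module.End ℝ (GroupLieAlgebra 𝓘(ℝ, E) G)}
    (hK : ∀ u v, scalarProduct g₀ (K u) v = LinearMap.trace ℝ _
      (LieAlgebra.ad ℝ (GroupLieAlgebra 𝓘(ℝ, E) G) u * LieAlgebra.ad ℝ _ v)) :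
    tensorNormSq (pullbackForm (scalarProduct g₀) l)
        (ricci (leftInvariantMetric (pullbackForm (scalarProduct g₀) l))) =
      LinearMap.trace ℝ _ (IsTwist.ricciOperator K l j Z * IsTwist.ricciOperator K l j Z) := by
  refine H.tensorNormSq_pullbackForm hZ (H.isSymm_killing hK) fun v w ↦ ?_
  have hconj : ∀ M : Module.End ℝ (GroupLieAlgebra 𝓘(ℝ, E) G),
      LinearMap.trace ℝ _ ((1 - l) * M * (1 + l)) = LinearMap.trace ℝ _ M := by
    intro M
    rw [mul_assoc, LinearMap.trace_mul_comm, mul_assoc, H.one_add_mul_one_sub, mul_one]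
  rw [ricci_leftInvariantMetric _ H.nondegenerate_pullbackForm H.isSymm_pullbackForm
    (((twistConnection l j).compl₁₂ (1 + l) (1 + l)).compr₂ (1 - l)) H.koszul_pullbackForm,
    twistConnection_conj_flip, twistConnection_conj_flip,
    ← H.neg_trace_twistConnection_flip_mul hexp hZ hK]
  · congr 1
    -- Both flips are conjugated by the same 1 + l, which drops out of the trace of their product.
    rw [← hconj ((twistConnection l j).flip ((1 + l) w) * _)]
    congr 1
    generalize (twistConnection l j).flip ((1 + l) w) = M
    generalize (twistConnection l j).flip ((1 + l) v) = M'
    calc (1 - l) * M * (1 + l) * ((1 - l) * M' * (1 + l)) =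
        (1 - l) * M * ((1 + l) * (1 - l)) * M' * (1 + l) := by noncomm_ring
      _ = _ := by rw [H.one_add_mul_one_sub]; noncomm_ring
  · intro W
    rw [twistConnection_conj_flip, hconj, H.trace_twistConnection_flip hexp hZ]

end Group

theorem IsTwist.trace_squareSum_sq {V : Type*} [LieRing V] [LieAlgebra ℝ V] {ι : Type*} [Fintype ι]
    (j : Module.End ℝ V) (Z : ι → V) :
    LinearMap.trace ℝ V (squareSum j Z * squareSum j Z) =
      ∑ p, ∑ q, LinearMap.trace ℝ V
        (LieAlgebra.ad ℝ V (j (Z p)) ^ 2 * LieAlgebra.ad ℝ V (j (Z q)) ^ 2) := by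
  simp only [squareSum, Finset.sum_mul_sum, map_sum, pow_two]

end LeftInvariantRicci

theorem theorem3p14
    {E : Type*} [NormedAddCommGroup E] [NormedSpace ℝ E] [FiniteDimensional ℝ E]
    {F : Type*} [NormedAddCommGroup F] [NormedSpace ℝ F] [FiniteDimensional ℝ F]
    -- a compact Lie group `G` with a bi-invariant metric `g₀`
    {G : Type*} [TopologicalSpace G] [T2Space G] [CompactSpace G] [ChartedSpace E G] [Group G]
    [LieGroup 𝓘(ℝ, E) ∞ G]
    (g₀ : ContMDiffRiemannianMetric 𝓘(ℝ, E) ∞ E (fun x : G ↦ TangentSpace 𝓘(ℝ, E) x))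
    (hg₀ : IsBiInvariant g₀)
    -- a torus in `G`: the image of a compact connected abelian Lie group under an injective
    -- smooth homomorphism, and its Lie algebra `𝔥`
    {H : Type*} [TopologicalSpace H] [T2Space H] [CompactSpace H] [ConnectedSpace H]
    [ChartedSpace F H] [CommGroup H] [LieGroup 𝓘(ℝ, F) ∞ H]
    (i : H →* G) (hi : ContMDiff 𝓘(ℝ, F) 𝓘(ℝ, E) ∞ i) (hinj : Function.Injective i)
    (𝔥 : Submodule ℝ (GroupLieAlgebra 𝓘(ℝ, E) G)) (h𝔥 : 𝔥 = LinearMap.range (differential (F := F) i))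
    -- the linear maps `l`, `l'` and condition (*3)
    (l l' : GroupLieAlgebra 𝓘(ℝ, E) G →ₗ[ℝ] GroupLieAlgebra 𝓘(ℝ, E) G)
    (hl : IsAdmissible (scalarProduct g₀) 𝔥 l) (hl' : IsAdmissible (scalarProduct g₀) 𝔥 l')
    (h3 : ∀ Z ∈ 𝔥, ∃ a : G,
      (∀ X : GroupLieAlgebra 𝓘(ℝ, E) G,
        scalarProduct g₀ (l' X) Z = scalarProduct g₀ (l (Ad a X)) Z) ∧
      ∀ W ∈ 𝔥, Ad a W = W)
    -- an orthonormal basis of `𝔥`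
    {r : ℕ} (Z : Module.Basis (Fin r) ℝ 𝔥)
    (hZ : ∀ p q, scalarProduct g₀ (Z p) (Z q) = if p = q then 1 else 0) :
    tensorNormSq (pullbackForm (scalarProduct g₀) l)
        (ricci (leftInvariantMetric (pullbackForm (scalarProduct g₀) l)))
      - tensorNormSq (pullbackForm (scalarProduct g₀) l')
        (ricci (leftInvariantMetric (pullbackForm (scalarProduct g₀) l')))
    = (1 / 4) *
      ((∑ p, ∑ q, LinearMap.trace ℝ (GroupLieAlgebra 𝓘(ℝ, E) G)
          (LieAlgebra.ad ℝ (GroupLieAlgebra 𝓘(ℝ, E) G) (transpose g₀ l (Z p)) ^ 2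
            * LieAlgebra.ad ℝ (GroupLieAlgebra 𝓘(ℝ, E) G) (transpose g₀ l (Z q)) ^ 2))
      - ∑ p, ∑ q, LinearMap.trace ℝ (GroupLieAlgebra 𝓘(ℝ, E) G)
          (LieAlgebra.ad ℝ (GroupLieAlgebra 𝓘(ℝ, E) G) (transpose g₀ l' (Z p)) ^ 2
            * LieAlgebra.ad ℝ (GroupLieAlgebra 𝓘(ℝ, E) G) (transpose g₀ l' (Z q)) ^ 2)) := by

  have habel : ∀ u ∈ 𝔥, ∀ v ∈ 𝔥, ⁅u, v⁆ = 0 := by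
    subst h𝔥
    rintro _ ⟨u, rfl⟩ _ ⟨v, rfl⟩
    exact lie_differential_eq_zero i hi u v
  obtain ⟨K, hK⟩ := exists_killing_operator (scalarProduct_nondegenerate g₀)
  have T := hl.isTwist hg₀ habel
  have T' := hl'.isTwist hg₀ habel
  have hmem : ∀ k, (Z k : GroupLieAlgebra 𝓘(ℝ, E) G) ∈ 𝔥 := fun k ↦ (Z k).2
  have hexp : ∀ u ∈ 𝔥, u = ∑ k, scalarProduct g₀ (Z k) u • (Z k : GroupLieAlgebra 𝓘(ℝ, E) G) :=
    fun u hu ↦ eq_sum_of_orthonormal Z hZ hu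
  rw [tensorNormSq_ricci_leftInvariantMetric T hmem hexp hK,
    tensorNormSq_ricci_leftInvariantMetric T' hmem hexp hK,
    T.trace_ricciOperator_sq_sub T' (isAligned_of_Ad hg₀ h3) hmem hexp hK,
    IsTwist.trace_squareSum_sq, IsTwist.trace_squareSum_sq]
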